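/- Let $\mathbb{D}=\{z\in\mathbb{C}:|z|<1\}$. For $\beta>0$ let $\mathcal{G}(\beta)$ be the class of analytic functions $f$ on $\mathbb{D}$ with $f(0)=0$, $f'(0)=1$, $f'\neq 0$ on $\mathbb{D}$ and $$\operatorname{Re}\left(1+\frac{zf''(z)}{f'(z)}\right)<1+\frac{\beta}{2}\qquad(z\in\mathbb{D}).$$ For $z_1,z_2\in\mathbb{D}$ put $$\lambda(z_1,z_2)=\frac12\log\frac{1+\rho(z_1,z_2)}{1-\rho(z_1,z_2)},\qquad \rho(z_1,z_2)=\left|\frac{z_1-z_2}{1-\overline{z_1}z_2}\right|,$$ and, for $f\in\mathcal{G}(\beta)$, $$\Delta_f(z_1,z_2)=\frac{|f(z_1)-f(z_2)|}{\sqrt{(1-|z_1|^2)|f'(z_1)|\,(1-|z_2|^2)|f'(z_2)|}}.$$ Let $\beta>\sqrt2-1$ and $\delta_\beta=\sqrt{\beta^2+2\beta-1}$. Then for every $f\in\mathcal{G}(\beta)$ $$\Delta_f(z_1,z_2)\ \ge\ \frac{1}{\delta_\beta}\sin\bigl(\delta_\beta\,\lambda(z_1,z_2)\bigr)\quad\text{for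 all } z_1,z_2\in\mathbb{D}\text{ with }\lambda(z_1,z_2)\le \frac{\pi}{\delta_\beta},$$ $$\Delta_f(z_1,z_2)\ \le\ \frac{1}{1+\beta}\sinh\bigl((1+\beta)\,\lambda(z_1,z_2)\bigr)\quad\text{for all } z_1,z_2\in\mathbb{D}.$$ Both inequalities are sharp, in the following sense. There is a function $f\in\mathcal{G}(\beta)$ such that: 1. for every $0<\delta<\delta_\beta$ there are $z_1,z_2\in\mathbb{D}$ with $\lambda(z_1,z_2)\le\pi/\delta_\beta$ and $\Delta_f(z_1,z_2)<\frac1\delta\sin(\delta\,\lambda(z_1,z_2))$; 2. for every $0<c<1+\beta$ there are $z_1,z_2\in\mathbb{D}$ with $\Delta_f(z_1,z_2)>\frac1c\sinh(c\,\lambda(z_1,z_2))$; moreover, for all $\ell>0$ and $\varepsilon>0$ there are $z_1,z_2\in\mathbb{D}$ with $\lambda(z_1,z_2)=\ell$ and $\Delta_f(z_1,z_2)>\frac{1}{1+\beta}\sinh((1+\beta)\ell)-\varepsilon$. -/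

import Mathlib

/-- The class `𝒢(β)`: analytic functions `f` on the open unit disk with `f 0 = 0`, `f' 0 = 1` and
`Re (1 + z f''(z) / f'(z)) < 1 + β / 2` on the disk. The quotient has to make sense,
so `f'` has no zero in the disk. -/
structure IsClassG (β : ℝ) (f : ℂ → ℂ) : Prop where
  analytic : DifferentiableOn ℂ f (Metric.ball 0 1)
  map_zero : f 0 = 0
  deriv_zero : deriv f 0 = 1
  deriv_ne_zero : ∀ z ∈ Metric.ball (0 : ℂ) 1, deriv f z ≠ 0
  re_lt : ∀ z ∈ Metric.ball (0 : ℂ) 1,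
    (1 + z * deriv (deriv f) z / deriv f z).re < 1 + β / 2

/-- The pseudo-hyperbolic distance `ρ` on the unit disk. -/
noncomputable def pseudoHypDist (z₁ z₂ : ℂ) : ℝ :=
  ‖(z₁ - z₂) / (1 - (starRingEnd ℂ) z₁ * z₂)‖

/-- The hyperbolic distance `λ` on the unit disk. -/
noncomputable def hypDist (z₁ z₂ : ℂ) : ℝ :=
  (1 / 2) * Real.log ((1 + pseudoHypDist z₁ z₂) / (1 - pseudoHypDist z₁ z₂))

/-- The two-point distortion quantity
`Δ_f(z₁, z₂) = |f(z₁) - f(z₂)| / √((1 - |z₁|²)|f'(z₁)| (1 - |z₂|²)|f'(z₂)|)`. -/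
noncomputable def twoPointDistortion (f : ℂ → ℂ) (z₁ z₂ : ℂ) : ℝ :=
  ‖f z₁ - f z₂‖ /
    Real.sqrt (((1 - ‖z₁‖ ^ 2) * ‖deriv f z₁‖) * ((1 - ‖z₂‖ ^ 2) * ‖deriv f z₂‖))

/-!
The condition defining `𝒢(β)` says that `T = f'' / f'` satisfies `Re (z T) < β / 2`, so that
`z T / (z T - β)` is a map of the disk into itself fixing `0`, and `φ = T / (z T - β)` is bounded by
`1`. Schwarz–Pick for `φ` turns this into the bound `|S_f| (1 - |z|²)² ≤ 2 (β² + 2 β)` for the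
Schwarzian derivative. Along a unit speed hyperbolic geodesic starting at `a`, the function
`(f - f a) / √f'`, suitably normalized, has modulus proportional to `Δ_f` and solves `v'' = q v`,
`v 0 = 0`, with `|q - 1| ≤ β² + 2 β`. Comparing with `v'' = -δ_β² v` and `v'' = (1 + β)² v`
gives the two bounds.

Both are sharp for the function with derivative `(1 - z) ^ β`. Its distortion between `x` and the
point at distance `t` on the geodesic from `x` in the direction `e` has a limit as `x → 1` in
`(-1, 1)`. For `e = 1` this limit is `sinh ((1 + β) t) / (1 + β)`. For `e = I` and small `t > 0` it
is a solution `u` of `u'' = p u`, `u 0 = 0`, `u' 0 = 1`, with `p 0 = -δ_β²`, hence smaller than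
`sin (δ t) / δ` as soon as `δ < δ_β`.
-/

open Set Filter Topology Metric
open scoped RealInnerProductSpace ComplexConjugate

section Comparison

theorem le_of_hasDerivAt_nonneg_of_tendsto {f f' : ℝ → ℝ} {a b L : ℝ}
    (hf : ∀ t ∈ Ioo a b, HasDerivAt f (f' t) t) (hf' : ∀ t ∈ Ioo a b, 0 ≤ f' t)
    (hL : Tendsto f (𝓝[>] a) (𝓝 L)) {t : ℝ} (ht : t ∈ Ioo a b) : L ≤ f t := by
  have hmono : MonotoneOn f (Ioo a b) :=
    monotoneOn_of_hasDerivWithinAt_nonneg (convex_Ioo a b)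
      (fun x hx => (hf x hx).continuousAt.continuousWithinAt)
      (fun x hx => (hf x (interior_subset hx)).hasDerivWithinAt)
      fun x hx => hf' x (interior_subset hx)
  refine le_of_tendsto hL ?_
  filter_upwards [Ioo_mem_nhdsGT ht.1] with x hx
  exact hmono ⟨hx.1, hx.2.trans ht.2⟩ ht hx.2.le

theorem tendsto_norm_div_of_hasDerivAt {E : Type*} [NormedAddCommGroup E] [NormedSpace ℝ E]
    {v : ℝ → E} {s : ℝ → ℝ} {v₁ : E} {s₁ : ℝ} (hv : HasDerivAt v v₁ 0) (hs : HasDerivAt s s₁ 0)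
    (hv₀ : v 0 = 0) (hs₀ : s 0 = 0) (hs₁ : s₁ ≠ 0) :
    Tendsto (fun t => ‖v t‖ / s t) (𝓝[>] 0) (𝓝 (‖v₁‖ / s₁)) := by
  have hv' : Tendsto (fun t : ℝ => t⁻¹ • v t) (𝓝[>] 0) (𝓝 v₁) := by
    simpa [hv₀] using hv.tendsto_slope_zero_right
  have hs' : Tendsto (fun t : ℝ => t⁻¹ • s t) (𝓝[>] 0) (𝓝 s₁) := by
    simpa [hs₀] using hs.tendsto_slope_zero_right
  refine (hv'.norm.div hs' hs₁).congr' ?_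
  filter_upwards [self_mem_nhdsWithin] with t (ht : 0 < t)
  rw [Pi.div_apply, norm_smul, norm_inv, Real.norm_of_nonneg ht.le, smul_eq_mul,
    mul_div_mul_left _ _ (inv_ne_zero ht.ne')]

section Sturm

variable {E : Type*} [NormedAddCommGroup E] [InnerProductSpace ℝ E]

theorem hasDerivAt_inner_sub_div_mul_norm_sq {v v' : ℝ → E} {v₂ : E} {s s' : ℝ → ℝ} {s₂ t : ℝ}
    (hv : HasDerivAt v (v' t) t) (hv' : HasDerivAt v' v₂ t) (hs : HasDerivAt s (s' t) t)
    (hs' : HasDerivAt s' s₂ t) (hst : s t ≠ 0) :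
    HasDerivAt (fun t => ⟪v t, v' t⟫ - s' t / s t * ‖v t‖ ^ 2)
      (‖v' t - (s' t / s t) • v t‖ ^ 2 + (s t * ⟪v t, v₂⟫ - s₂ * ‖v t‖ ^ 2) / s t) t := by
  refine ((hv.inner ℝ hv').sub ((hs'.div hs hst).mul hv.norm_sq)).congr_deriv ?_
  rw [norm_sub_sq_real, inner_smul_right, norm_smul, mul_pow, Real.norm_eq_abs, sq_abs,
    real_inner_self_eq_norm_sq, real_inner_comm (v t) (v' t), Pi.div_apply]
  field_simp
  ring

theorem hasDerivAt_norm_sq_div_sq {v : ℝ → E} {v₁ : E} {s : ℝ → ℝ} {s₁ t : ℝ}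
    (hv : HasDerivAt v v₁ t) (hs : HasDerivAt s s₁ t) (hst : s t ≠ 0) :
    HasDerivAt (fun t => (‖v t‖ / s t) ^ 2)
      (2 * (⟪v t, v₁⟫ - s₁ / s t * ‖v t‖ ^ 2) / s t ^ 2) t := by
  simp only [div_pow]
  refine (hv.norm_sq.div (hs.pow 2) (pow_ne_zero 2 hst)).congr_deriv ?_
  simp only [Pi.pow_apply]
  field_simp
  ring

variable {v v' v'' : ℝ → E} {s s' s'' : ℝ → ℝ} {r : ℝ}

/-- **Sturm comparison** of `v'' = q v` and `s'' = p s`, where `p ≤ q` is expressed without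
dividing by `v` or `s`. -/
theorem norm_deriv_mul_le_mul_norm_of_sturm
    (hv : ∀ t ∈ Ico 0 r, HasDerivAt v (v' t) t) (hv' : ∀ t ∈ Ico 0 r, HasDerivAt v' (v'' t) t)
    (hs : ∀ t ∈ Ico 0 r, HasDerivAt s (s' t) t) (hs' : ∀ t ∈ Ico 0 r, HasDerivAt s' (s'' t) t)
    (hpos : ∀ t ∈ Ioo 0 r, 0 < s t)
    (hle : ∀ t ∈ Ioo 0 r, s'' t * ‖v t‖ ^ 2 ≤ s t * ⟪v t, v'' t⟫)
    (hv₀ : v 0 = 0) (hs₀ : s 0 = 0) (hs₁ : 0 < s' 0) {t : ℝ} (ht : t ∈ Ioo 0 r) :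
    ‖v' 0‖ * s t ≤ s' 0 * ‖v t‖ := by
  have h0 : (0 : ℝ) ∈ Ico 0 r := ⟨le_rfl, ht.1.trans ht.2⟩
  have hratio := tendsto_norm_div_of_hasDerivAt (hv 0 h0) (hs 0 h0) hv₀ hs₀ hs₁.ne'
  have hcross₀ : Tendsto (fun t => ⟪v t, v' t⟫ - s' t / s t * ‖v t‖ ^ 2) (𝓝[>] 0) (𝓝 0) := by
    have hvc := (hv 0 h0).continuousAt
    have hvc' := (hv' 0 h0).continuousAt
    have hinner := (hvc.inner (𝕜 := ℝ) hvc').tendsto.mono_left (nhdsWithin_le_nhds (s := Ioi 0))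
    have hprod := ((hvc.norm.mul (hs' 0 h0).continuousAt).tendsto.mono_left
      (nhdsWithin_le_nhds (s := Ioi 0))).mul hratio
    have hsub := hinner.sub hprod
    simp only [hv₀, inner_zero_left, Pi.mul_apply, norm_zero, zero_mul, sub_zero] at hsub
    exact hsub.congr fun t => by ring
  have hcross : ∀ t ∈ Ioo 0 r, 0 ≤ ⟪v t, v' t⟫ - s' t / s t * ‖v t‖ ^ 2 := fun t ht =>
    le_of_hasDerivAt_nonneg_of_tendsto
      (fun t ht => hasDerivAt_inner_sub_div_mul_norm_sq (hv t (Ioo_subset_Ico_self ht))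
        (hv' t (Ioo_subset_Ico_self ht)) (hs t (Ioo_subset_Ico_self ht))
        (hs' t (Ioo_subset_Ico_self ht)) (hpos t ht).ne')
      (fun t ht => add_nonneg (sq_nonneg _)
        (div_nonneg (sub_nonneg.2 (hle t ht)) (hpos t ht).le)) hcross₀ ht
  have hsq : (‖v' 0‖ / s' 0) ^ 2 ≤ (‖v t‖ / s t) ^ 2 :=
    le_of_hasDerivAt_nonneg_of_tendsto
      (fun t ht => hasDerivAt_norm_sq_div_sq (hv t (Ioo_subset_Ico_self ht))
        (hs t (Ioo_subset_Ico_self ht)) (hpos t ht).ne')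
      (fun t ht => div_nonneg (mul_nonneg zero_le_two (hcross t ht)) (sq_nonneg _))
      (hratio.pow 2) ht
  have hst := hpos t ht
  have := le_of_sq_le_sq hsq (by positivity)
  rwa [div_le_div_iff₀ hs₁ hst, mul_comm ‖v t‖] at this

theorem norm_deriv_mul_sin_div_le_norm {δ : ℝ} (hδ : 0 < δ) (hv : ∀ t, HasDerivAt v (v' t) t)
    (hv' : ∀ t, HasDerivAt v' (v'' t) t) (hle : ∀ t, -δ ^ 2 * ‖v t‖ ^ 2 ≤ ⟪v t, v'' t⟫)
    (hv₀ : v 0 = 0) {t : ℝ} (ht₀ : 0 ≤ t) (ht : t ≤ Real.pi / δ) :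
    ‖v' 0‖ * (Real.sin (δ * t) / δ) ≤ ‖v t‖ := by
  rcases ht₀.eq_or_lt with rfl | ht₀
  · simp
  rcases ht.eq_or_lt with rfl | ht
  · simp [mul_div_cancel₀ _ hδ.ne']
  have hsin : ∀ t ∈ Ioo 0 (Real.pi / δ), 0 < Real.sin (δ * t) := fun t ht =>
    Real.sin_pos_of_pos_of_lt_pi (mul_pos hδ ht.1) ((lt_div_iff₀' hδ).1 ht.2)
  have key := norm_deriv_mul_le_mul_norm_of_sturm (s := fun t => Real.sin (δ * t))
    (s' := fun t => Real.cos (δ * t) * δ) (s'' := fun t => -Real.sin (δ * t) * δ * δ)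
    (fun t _ => hv t) (fun t _ => hv' t)
    (fun t _ => by simpa using ((hasDerivAt_id t).const_mul δ).sin)
    (fun t _ => by simpa using (((hasDerivAt_id t).const_mul δ).cos).mul_const δ) hsin
    (fun t ht => by linarith [mul_le_mul_of_nonneg_left (hle t) (hsin t ht).le])
    hv₀ (by simp) (by simpa using hδ) ⟨ht₀, ht⟩
  rw [mul_zero, Real.cos_zero, one_mul] at key
  rwa [← mul_div_assoc, div_le_iff₀' hδ]

end Sturm

section Growth

variable {E : Type*} [NormedAddCommGroup E] [NormedSpace ℝ E] {v v' v'' : ℝ → E}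

theorem exists_majorant_of_norm_deriv2_le {c A : ℝ} (hc : 0 ≤ c)
    (hv : ∀ t, HasDerivAt v (v' t) t) (hv' : ∀ t, HasDerivAt v' (v'' t) t)
    (hle : ∀ t, ‖v'' t‖ ≤ c * ‖v t‖) (hv₀ : v 0 = 0) (hA : ‖v' 0‖ < A) :
    ∃ J J' : ℝ → ℝ, (∀ t, HasDerivAt J (J' t) t) ∧ (∀ t, HasDerivAt J' (c * ‖v t‖) t) ∧
      J 0 = 0 ∧ J' 0 = A ∧ (∀ t, 0 < t → 0 < J t) ∧ ∀ t, 0 ≤ t → ‖v t‖ ≤ J t := by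
  have hvc : Continuous v := continuous_iff_continuousAt.2 fun t => (hv t).continuousAt
  have hvc' : Continuous v' := continuous_iff_continuousAt.2 fun t => (hv' t).continuousAt
  set B : ℝ → ℝ := fun t => A + ∫ x in (0 : ℝ)..t, c * ‖v x‖
  have hB : ∀ t, HasDerivAt B (c * ‖v t‖) t := fun t =>
    ((continuous_const.mul hvc.norm).integral_hasStrictDerivAt 0 t).hasDerivAt.const_add A
  have hBc : Continuous B := continuous_iff_continuousAt.2 fun t => (hB t).continuousAt
  have hB₀ : B 0 = A := by simp [B]
  have hBpos : ∀ t, 0 ≤ t → 0 < B t := fun t ht =>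
    add_pos_of_pos_of_nonneg ((norm_nonneg _).trans_lt hA)
      (intervalIntegral.integral_nonneg ht fun x _ => by positivity)
  have hJ : ∀ t, HasDerivAt (fun t => ∫ x in (0 : ℝ)..t, B x) (B t) t := fun t =>
    (hBc.integral_hasStrictDerivAt 0 t).hasDerivAt
  have hv'B : ∀ t, 0 ≤ t → ‖v' t‖ ≤ B t := fun t ht =>
    image_norm_le_of_norm_deriv_right_le_deriv_boundary hvc'.continuousOn
      (fun x _ => (hv' x).hasDerivWithinAt) (hA.le.trans_eq hB₀.symm) hB (fun x _ => hle x)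
      ⟨ht, le_rfl⟩
  refine ⟨_, B, hJ, hB, by simp, hB₀, fun t ht => ?_, fun t ht => ?_⟩
  · exact intervalIntegral.intervalIntegral_pos_of_pos_on (hBc.intervalIntegrable 0 t)
      (fun x hx => hBpos x hx.1.le) ht
  · exact image_norm_le_of_norm_deriv_right_le_deriv_boundary hvc.continuousOn
      (fun x _ => (hv x).hasDerivWithinAt) (by simp [hv₀]) hJ (fun x hx => hv'B x hx.1) ⟨ht, le_rfl⟩

theorem norm_le_norm_deriv_mul_sinh_div {k : ℝ} (hk : 0 < k) (hv : ∀ t, HasDerivAt v (v' t) t)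
    (hv' : ∀ t, HasDerivAt v' (v'' t) t) (hle : ∀ t, ‖v'' t‖ ≤ k ^ 2 * ‖v t‖) (hv₀ : v 0 = 0)
    {t : ℝ} (ht : 0 ≤ t) : ‖v t‖ ≤ ‖v' 0‖ * (Real.sinh (k * t) / k) := by
  rcases ht.eq_or_lt with rfl | ht
  · simp [hv₀]
  have hsinh : ∀ t, 0 < t → 0 < Real.sinh (k * t) := fun t ht =>
    Real.sinh_pos_iff.2 (mul_pos hk ht)
  rw [← div_le_iff₀ (div_pos (hsinh t ht) hk)]
  refine le_of_forall_gt_imp_ge_of_dense fun A hA => ?_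
  obtain ⟨J, J', hJ, hJ', hJ₀, hJ'₀, hJpos, hvJ⟩ :=
    exists_majorant_of_norm_deriv2_le (sq_nonneg k) hv hv' hle hv₀ hA
  -- `J'' = k² ‖v‖ ≤ k² J`, so `J` grows at most like `sinh (k t)`
  have key := norm_deriv_mul_le_mul_norm_of_sturm (r := t + 1)
    (v := fun t => Real.sinh (k * t)) (v' := fun t => Real.cosh (k * t) * k)
    (v'' := fun t => Real.sinh (k * t) * k * k)
    (fun t _ => by simpa using ((hasDerivAt_id t).const_mul k).sinh)
    (fun t _ => by simpa using (((hasDerivAt_id t).const_mul k).cosh).mul_const k)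
    (fun t _ => hJ t) (fun t _ => hJ' t) (fun t ht => hJpos t ht.1)
    (fun x hx => by
      have := mul_le_mul_of_nonneg_left (hvJ x hx.1.le) (mul_nonneg (sq_nonneg k)
        (sq_nonneg (Real.sinh (k * x))))
      rw [Real.norm_eq_abs, sq_abs, RCLike.inner_apply, conj_trivial]
      linarith)
    (by simp) hJ₀ (hJ'₀ ▸ (norm_nonneg _).trans_lt hA) ⟨ht, lt_add_one t⟩
  rw [mul_zero, Real.cosh_zero, one_mul, Real.norm_of_nonneg hk.le,
    Real.norm_of_nonneg (hsinh t ht).le, hJ'₀] at key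
  rw [div_le_iff₀ (div_pos (hsinh t ht) hk), mul_div_assoc', le_div_iff₀' hk]
  exact (mul_le_mul_of_nonneg_left (hvJ t ht.le) hk.le).trans key

end Growth

end Comparison

section SchwarzPick

/-- The disk automorphism taking `0` to `a`. -/
noncomputable def diskMobius (a z : ℂ) : ℂ := (a + z) / (1 + conj a * z)

theorem norm_one_add_conj_mul_sq_sub (a z : ℂ) :
    ‖1 + conj a * z‖ ^ 2 - ‖a + z‖ ^ 2 = (1 - ‖a‖ ^ 2) * (1 - ‖z‖ ^ 2) := by
  simp only [Complex.sq_norm, Complex.normSq_apply, Complex.add_re, Complex.add_im, Complex.mul_re,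
    Complex.mul_im, Complex.one_re, Complex.one_im, Complex.conj_re, Complex.conj_im]
  ring

theorem one_sub_norm_sq_pos {z : ℂ} (hz : ‖z‖ < 1) : 0 < 1 - ‖z‖ ^ 2 :=
  sub_pos.2 (pow_lt_one₀ (norm_nonneg z) hz two_ne_zero)

variable {a z : ℂ}

theorem one_add_conj_mul_ne_zero (ha : ‖a‖ < 1) (hz : ‖z‖ < 1) : 1 + conj a * z ≠ 0 := by
  have hpos := mul_pos (one_sub_norm_sq_pos ha) (one_sub_norm_sq_pos hz)
  rw [← norm_one_add_conj_mul_sq_sub] at hpos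
  exact norm_ne_zero_iff.1 fun h => by nlinarith [sq_nonneg ‖a + z‖]

theorem norm_diskMobius_lt_one (ha : ‖a‖ < 1) (hz : ‖z‖ < 1) : ‖diskMobius a z‖ < 1 := by
  rw [diskMobius, norm_div, div_lt_one (norm_pos_iff.2 (one_add_conj_mul_ne_zero ha hz))]
  have hpos := mul_pos (one_sub_norm_sq_pos ha) (one_sub_norm_sq_pos hz)
  rw [← norm_one_add_conj_mul_sq_sub] at hpos
  exact lt_of_pow_lt_pow_left₀ 2 (norm_nonneg _) (sub_pos.1 hpos)

theorem mapsTo_diskMobius (ha : ‖a‖ < 1) : MapsTo (diskMobius a) (ball 0 1) (ball 0 1) :=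
  fun _ hz => mem_ball_zero_iff.2 (norm_diskMobius_lt_one ha (mem_ball_zero_iff.1 hz))

theorem hasDerivAt_diskMobius (h : 1 + conj a * z ≠ 0) :
    HasDerivAt (diskMobius a) (((1 - ‖a‖ ^ 2 : ℝ) : ℂ) / (1 + conj a * z) ^ 2) z := by
  refine (((hasDerivAt_id z).const_add a).div
    (((hasDerivAt_id z).const_mul (conj a)).const_add 1) h).congr_deriv ?_
  push_cast
  rw [← Complex.conj_mul' a]
  simp only [id]
  ring

theorem differentiableOn_diskMobius (ha : ‖a‖ < 1) :
    DifferentiableOn ℂ (diskMobius a) (ball 0 1) := fun _ hz =>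
  (hasDerivAt_diskMobius (one_add_conj_mul_ne_zero ha
    (mem_ball_zero_iff.1 hz))).differentiableAt.differentiableWithinAt

theorem diskMobius_zero_right (a : ℂ) : diskMobius a 0 = a := by simp [diskMobius]

theorem hasDerivAt_diskMobius_zero (a : ℂ) :
    HasDerivAt (diskMobius a) ((1 - ‖a‖ ^ 2 : ℝ) : ℂ) 0 := by
  simpa using hasDerivAt_diskMobius (a := a) (z := 0) (by simp)

theorem hasDerivAt_diskMobius_neg_self (ha : ‖a‖ < 1) :
    HasDerivAt (diskMobius (-a)) (((1 - ‖a‖ ^ 2 : ℝ) : ℂ)⁻¹) a := by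
  have hden : 1 + conj (-a) * a = ((1 - ‖a‖ ^ 2 : ℝ) : ℂ) := by
    push_cast
    rw [map_neg, neg_mul, Complex.conj_mul', sub_eq_add_neg]
  have hne : ((1 - ‖a‖ ^ 2 : ℝ) : ℂ) ≠ 0 := Complex.ofReal_ne_zero.2 (one_sub_norm_sq_pos ha).ne'
  refine (hasDerivAt_diskMobius (hden ▸ hne)).congr_deriv ?_
  rw [hden, norm_neg, div_eq_iff (pow_ne_zero 2 hne), sq ((_ : ℝ) : ℂ), inv_mul_cancel_left₀ hne]

theorem norm_deriv_mul_le_of_mapsTo_ball {φ : ℂ → ℂ} (hd : DifferentiableOn ℂ φ (ball 0 1))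
    (hm : MapsTo φ (ball 0 1) (ball 0 1)) (hz : ‖z‖ < 1) :
    ‖deriv φ z‖ * (1 - ‖z‖ ^ 2) ≤ 1 - ‖φ z‖ ^ 2 := by
  have hφz : ‖φ z‖ < 1 := mem_ball_zero_iff.1 (hm (mem_ball_zero_iff.2 hz))
  have hφz' : ‖-φ z‖ < 1 := by rwa [norm_neg]
  set G : ℂ → ℂ := fun ζ => diskMobius (-φ z) (φ (diskMobius z ζ))
  have hmap : MapsTo G (ball 0 1) (ball 0 1) :=
    (mapsTo_diskMobius hφz').comp (hm.comp (mapsTo_diskMobius hz))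
  have hG₀ : G 0 = 0 := by simp [G, diskMobius]
  have hderiv : HasDerivAt G
      (((1 - ‖φ z‖ ^ 2 : ℝ) : ℂ)⁻¹ * (deriv φ z * ((1 - ‖z‖ ^ 2 : ℝ) : ℂ))) 0 := by
    have hφ : HasDerivAt φ (deriv φ z) (diskMobius z 0) := by
      rw [diskMobius_zero_right]
      exact (hd.differentiableAt (isOpen_ball.mem_nhds (mem_ball_zero_iff.2 hz))).hasDerivAt
    have hout : HasDerivAt (diskMobius (-φ z)) (((1 - ‖φ z‖ ^ 2 : ℝ) : ℂ)⁻¹)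
        (φ (diskMobius z 0)) := by
      rw [diskMobius_zero_right]
      exact hasDerivAt_diskMobius_neg_self hφz
    exact hout.comp 0 (hφ.comp 0 (hasDerivAt_diskMobius_zero z))
  have key := Complex.norm_deriv_le_one_of_mapsTo_ball (f := G) (c := 0) (R := 1)
    ((differentiableOn_diskMobius hφz').comp (hd.comp (differentiableOn_diskMobius hz)
      (mapsTo_diskMobius hz)) (hm.comp (mapsTo_diskMobius hz)))
    (by rw [hG₀]; exact hmap.mono_right ball_subset_closedBall) one_pos
  have hpos := one_sub_norm_sq_pos hφz
  rwa [hderiv.deriv, norm_mul, norm_mul, norm_inv, Complex.norm_of_nonneg hpos.le,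
    Complex.norm_of_nonneg (one_sub_norm_sq_pos hz).le, inv_mul_le_iff₀ hpos, mul_one] at key

theorem norm_deriv_mul_le_of_mapsTo_closedBall {φ : ℂ → ℂ}
    (hd : DifferentiableOn ℂ φ (ball 0 1)) (hm : MapsTo φ (ball 0 1) (closedBall 0 1))
    (hz : ‖z‖ < 1) : ‖deriv φ z‖ * (1 - ‖z‖ ^ 2) ≤ 1 - ‖φ z‖ ^ 2 := by
  have hscaled : ∀ r ∈ Ioo (0 : ℝ) 1,
      r * ‖deriv φ z‖ * (1 - ‖z‖ ^ 2) ≤ 1 - (r * ‖φ z‖) ^ 2 := by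
    intro r hr
    have hmap : MapsTo (fun w => (r : ℂ) * φ w) (ball 0 1) (ball 0 1) := fun w hw => by
      rw [mem_ball_zero_iff, norm_mul, Complex.norm_of_nonneg hr.1.le]
      exact (mul_le_of_le_one_right hr.1.le (mem_closedBall_zero_iff.1 (hm hw))).trans_lt hr.2
    simpa only [deriv_const_mul_field, norm_mul, Complex.norm_of_nonneg hr.1.le]
      using norm_deriv_mul_le_of_mapsTo_ball (hd.const_mul (r : ℂ)) hmap hz
  have hleft : Continuous fun r : ℝ => r * ‖deriv φ z‖ * (1 - ‖z‖ ^ 2) := by fun_prop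
  have hright : Continuous fun r : ℝ => 1 - (r * ‖φ z‖) ^ 2 := by fun_prop
  simpa using le_of_tendsto_of_tendsto ((hleft.tendsto 1).mono_left nhdsWithin_le_nhds)
    ((hright.tendsto 1).mono_left nhdsWithin_le_nhds)
    (eventually_of_mem (Ioo_mem_nhdsLT one_pos) hscaled)

end SchwarzPick

section Schwarzian

/-- The pre-Schwarzian derivative `f'' / f'`. -/
noncomputable def preSchwarzian (f : ℂ → ℂ) (z : ℂ) : ℂ := deriv (deriv f) z / deriv f z

/-- The Schwarzian derivative `(f'' / f')' - (f'' / f')² / 2`. -/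
noncomputable def schwarzian (f : ℂ → ℂ) (z : ℂ) : ℂ :=
  deriv (preSchwarzian f) z - preSchwarzian f z ^ 2 / 2

variable {f : ℂ → ℂ} {z : ℂ}

theorem differentiableOn_preSchwarzian (hf : DifferentiableOn ℂ f (ball 0 1))
    (hf' : ∀ z ∈ ball (0 : ℂ) 1, deriv f z ≠ 0) :
    DifferentiableOn ℂ (preSchwarzian f) (ball 0 1) :=
  ((hf.deriv isOpen_ball).deriv isOpen_ball).div (hf.deriv isOpen_ball) hf'

/-- The classical linearization `h'' = -(S_f / 2) h` of the Schwarzian. -/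
theorem exists_inv_sqrt_deriv (hf : DifferentiableOn ℂ f (ball 0 1))
    (hf' : ∀ z ∈ ball (0 : ℂ) 1, deriv f z ≠ 0) :
    ∃ h : ℂ → ℂ, ∀ z ∈ ball (0 : ℂ) 1, h z ^ 2 * deriv f z = 1 ∧
      HasDerivAt h (deriv h z) z ∧ HasDerivAt (deriv h) (-(schwarzian f z / 2) * h z) z := by
  have hT := differentiableOn_preSchwarzian hf hf'
  obtain ⟨F, hF₀, hF⟩ := hT.isExactOn_ball.with_val_at 0 (Complex.log (deriv f 0))
  have hconst : ∀ z ∈ ball (0 : ℂ) 1,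
      HasDerivAt (fun z => Complex.exp (-F z) * deriv f z) 0 z := by
    intro z hz
    have hf'' := ((hf.deriv isOpen_ball).differentiableAt (isOpen_ball.mem_nhds hz)).hasDerivAt
    refine ((hF z hz).neg.cexp.mul hf'').congr_deriv ?_
    have := hf' z hz
    simp only [preSchwarzian, Pi.neg_apply]
    field_simp
    ring
  have hexp : ∀ z ∈ ball (0 : ℂ) 1, Complex.exp (-F z) * deriv f z = 1 := by
    intro z hz
    have h0 : (0 : ℂ) ∈ ball (0 : ℂ) 1 := mem_ball_self one_pos
    rw [isOpen_ball.is_const_of_deriv_eq_zero (convex_ball (0 : ℂ) 1).isPreconnected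
      (fun w hw => (hconst w hw).differentiableAt.differentiableWithinAt)
      (fun w hw => (hconst w hw).deriv) hz h0, hF₀, Complex.exp_neg,
      Complex.exp_log (hf' 0 h0), inv_mul_cancel₀ (hf' 0 h0)]
  set h : ℂ → ℂ := fun z => Complex.exp (-F z / 2)
  have hh : ∀ z ∈ ball (0 : ℂ) 1, HasDerivAt h (-(preSchwarzian f z / 2) * h z) z := fun z hz =>
    ((hF z hz).neg.div_const 2).cexp.congr_deriv (by simp only [Pi.neg_apply, h]; ring)
  refine ⟨h, fun z hz => ⟨?_, (hh z hz).differentiableAt.hasDerivAt, ?_⟩⟩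
  · rw [← hexp z hz, ← Complex.exp_nat_mul]
    push_cast
    ring_nf
  · have hTz := (hT.differentiableAt (isOpen_ball.mem_nhds hz)).hasDerivAt
    refine (((hTz.div_const 2).neg.mul (hh z hz)).congr_of_eventuallyEq ?_).congr_deriv ?_
    · filter_upwards [isOpen_ball.mem_nhds hz] with w hw
      exact (hh w hw).deriv
    · simp only [schwarzian, Pi.neg_apply]
      ring

theorem norm_le_one_of_norm_mul_le_one {φ : ℂ → ℂ} (hφ : DifferentiableOn ℂ φ (ball 0 1))
    (hle : ∀ z ∈ ball (0 : ℂ) 1, ‖z * φ z‖ ≤ 1) (hz : z ∈ ball 0 1) : ‖φ z‖ ≤ 1 := by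
  have hd : DifferentiableOn ℂ (fun z => z * φ z) (ball 0 1) := differentiableOn_id.mul hφ
  have hschwarz := Complex.norm_dslope_le_div_of_mapsTo_ball hd
    (fun z hz => by simpa using hle z hz : MapsTo _ _ (closedBall _ 1)) hz
  have hdslope : dslope (fun z => z * φ z) 0 z = φ z := by
    rcases eq_or_ne z 0 with rfl | hz₀
    · have hφ₀ := (hφ.differentiableAt (isOpen_ball.mem_nhds hz)).hasDerivAt
      rw [dslope_same]
      simpa using ((hasDerivAt_id (0 : ℂ)).fun_mul hφ₀).deriv
    · simpa using dslope_sub_smul_of_ne φ hz₀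
  rwa [hdslope, div_one] at hschwarz

theorem norm_lt_norm_sub_of_re_lt {β : ℝ} (hβ : 0 < β) {w : ℂ} (hw : w.re < β / 2) :
    ‖w‖ < ‖w - β‖ := by
  refine lt_of_pow_lt_pow_left₀ 2 (norm_nonneg _) ?_
  rw [Complex.sq_norm, Complex.sq_norm, Complex.normSq_apply, Complex.normSq_apply,
    Complex.sub_re, Complex.sub_im, Complex.ofReal_re, Complex.ofReal_im]
  nlinarith

/-- Expresses the Schwarzian of `f` with `T = f'' / f'` through `φ = T / (z T - β)` and `φ'`, the
latter written out by the quotient rule. -/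
theorem sub_sq_div_two_eq {β T T' z : ℂ} (hβ : β ≠ 0) (hne : z * T - β ≠ 0) :
    T' - T ^ 2 / 2 = -β * (((T' * (z * T - β) - T * (T + z * T')) / (z * T - β) ^ 2 +
      (1 + β / 2) * (T / (z * T - β)) ^ 2) / (1 - z * (T / (z * T - β))) ^ 2) := by
  have hone : 1 - z * (T / (z * T - β)) = -β / (z * T - β) := by field_simp; ring
  rw [hone]
  generalize hX : z * T - β = X at hne
  field_simp
  rw [← hX]
  ring

theorem add_mul_sq_mul_sq_le {β r s d : ℝ} (hβ : 0 ≤ β) (hr₀ : 0 ≤ r) (hr : r < 1) (hs₀ : 0 ≤ s)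
    (hs : s ≤ 1) (hd : d * (1 - r ^ 2) ≤ 1 - s ^ 2) :
    (d + (1 + β / 2) * s ^ 2) * (1 - r ^ 2) ^ 2 ≤ (4 + 2 * β) * (1 - r * s) ^ 2 := by
  have hrs : r * s ≤ r := mul_le_of_le_one_right hr₀ hs
  have hr2 : 0 < 1 - r ^ 2 := sub_pos.2 (pow_lt_one₀ hr₀ hr two_ne_zero)
  have hsq : ((1 - r ^ 2) * s) ^ 2 ≤ (2 * (1 - r * s)) ^ 2 :=
    pow_le_pow_left₀ (mul_nonneg hr2.le hs₀)
      (by nlinarith [mul_nonneg hs₀ (sq_nonneg (1 - r))]) 2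
  have hsum : (1 - r ^ 2) * (1 - s ^ 2) + ((1 - r ^ 2) * s) ^ 2 ≤ 4 * (1 - r * s) ^ 2 :=
    calc (1 - r ^ 2) * (1 - s ^ 2) + ((1 - r ^ 2) * s) ^ 2
        = (1 - r) * (1 + r) * (1 + r * s) * (1 - r * s) := by ring
      _ ≤ (1 - r * s) * 2 * 2 * (1 - r * s) := by
        gcongr
        · linarith
        · nlinarith
        · linarith
        · linarith
        · linarith
      _ = 4 * (1 - r * s) ^ 2 := by ring
  calc (d + (1 + β / 2) * s ^ 2) * (1 - r ^ 2) ^ 2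
      = d * (1 - r ^ 2) * (1 - r ^ 2) + ((1 - r ^ 2) * s) ^ 2 +
          β / 2 * ((1 - r ^ 2) * s) ^ 2 := by ring
    _ ≤ (1 - s ^ 2) * (1 - r ^ 2) + ((1 - r ^ 2) * s) ^ 2 + β / 2 * (2 * (1 - r * s)) ^ 2 := by
      gcongr
    _ ≤ (4 + 2 * β) * (1 - r * s) ^ 2 := by linarith

theorem norm_add_mul_sq_div_mul_sq_le {β : ℝ} {D s z : ℂ} (hβ : 0 ≤ β) (hz : ‖z‖ < 1)
    (hs : ‖s‖ ≤ 1) (hD : ‖D‖ * (1 - ‖z‖ ^ 2) ≤ 1 - ‖s‖ ^ 2) :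
    ‖(D + (1 + β / 2) * s ^ 2) / (1 - z * s) ^ 2‖ * (1 - ‖z‖ ^ 2) ^ 2 ≤ 4 + 2 * β := by
  have hnum : ‖D + (1 + β / 2) * s ^ 2‖ ≤ ‖D‖ + (1 + β / 2) * ‖s‖ ^ 2 := by
    refine (norm_add_le _ _).trans_eq ?_
    rw [norm_mul, norm_pow, show (1 + β / 2 : ℂ) = ((1 + β / 2 : ℝ) : ℂ) by push_cast; rfl,
      Complex.norm_of_nonneg (by positivity)]
  have hzs : ‖z‖ * ‖s‖ < 1 := (mul_le_of_le_one_right (norm_nonneg z) hs).trans_lt hz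
  have hden : 1 - ‖z‖ * ‖s‖ ≤ ‖1 - z * s‖ := by
    simpa using norm_sub_norm_le (1 : ℂ) (z * s)
  have hpos : 0 < ‖1 - z * s‖ := (sub_pos.2 hzs).trans_le hden
  rw [norm_div, norm_pow, div_mul_eq_mul_div, div_le_iff₀ (pow_pos hpos 2)]
  calc ‖D + (1 + β / 2) * s ^ 2‖ * (1 - ‖z‖ ^ 2) ^ 2
      ≤ (‖D‖ + (1 + β / 2) * ‖s‖ ^ 2) * (1 - ‖z‖ ^ 2) ^ 2 := by gcongr
    _ ≤ (4 + 2 * β) * (1 - ‖z‖ * ‖s‖) ^ 2 :=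
      add_mul_sq_mul_sq_le hβ (norm_nonneg z) hz (norm_nonneg s) hs hD
    _ ≤ (4 + 2 * β) * ‖1 - z * s‖ ^ 2 := by
      gcongr

theorem norm_deriv_sub_sq_div_two_mul_le {T : ℂ → ℂ} {β : ℝ} (hβ : 0 < β)
    (hT : DifferentiableOn ℂ T (ball 0 1))
    (hre : ∀ z ∈ ball (0 : ℂ) 1, (z * T z).re < β / 2) (hz : z ∈ ball 0 1) :
    ‖deriv T z - T z ^ 2 / 2‖ * (1 - ‖z‖ ^ 2) ^ 2 ≤ 2 * (β ^ 2 + 2 * β) := by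
  have hlt : ∀ z ∈ ball (0 : ℂ) 1, ‖z * T z‖ < ‖z * T z - β‖ := fun z hz =>
    norm_lt_norm_sub_of_re_lt hβ (hre z hz)
  have hne : ∀ z ∈ ball (0 : ℂ) 1, z * T z - β ≠ 0 := fun z hz =>
    norm_pos_iff.1 ((norm_nonneg _).trans_lt (hlt z hz))
  set φ : ℂ → ℂ := fun z => T z / (z * T z - β)
  have hφ : DifferentiableOn ℂ φ (ball 0 1) :=
    hT.div ((differentiableOn_id.mul hT).sub_const _) hne
  have hφ_le : ∀ z ∈ ball (0 : ℂ) 1, ‖φ z‖ ≤ 1 := fun z hz =>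
    norm_le_one_of_norm_mul_le_one hφ (fun w hw => by
      rw [← mul_div_assoc, norm_div]
      exact div_le_one_of_le₀ (hlt w hw).le (norm_nonneg _)) hz
  have hpick := norm_deriv_mul_le_of_mapsTo_closedBall hφ
    (fun w hw => mem_closedBall_zero_iff.2 (hφ_le w hw)) (mem_ball_zero_iff.1 hz)
  have hTz := (hT.differentiableAt (isOpen_ball.mem_nhds hz)).hasDerivAt
  have hφ' : deriv φ z =
      (deriv T z * (z * T z - β) - T z * (T z + z * deriv T z)) / (z * T z - β) ^ 2 := by
    simpa using (hTz.fun_div (((hasDerivAt_id z).fun_mul hTz).sub_const (β : ℂ)) (hne z hz)).deriv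
  rw [sub_sq_div_two_eq (Complex.ofReal_ne_zero.2 hβ.ne') (hne z hz), ← hφ', norm_mul, norm_neg,
    Complex.norm_of_nonneg hβ.le, mul_assoc]
  calc _ ≤ β * (4 + 2 * β) := by
        gcongr
        exact norm_add_mul_sq_div_mul_sq_le hβ.le (mem_ball_zero_iff.1 hz) (hφ_le z hz) hpick
    _ = 2 * (β ^ 2 + 2 * β) := by ring

theorem IsClassG.norm_schwarzian_mul_le {β : ℝ} (hβ : 0 < β) (hf : IsClassG β f)
    (hz : z ∈ ball 0 1) : ‖schwarzian f z‖ * (1 - ‖z‖ ^ 2) ^ 2 ≤ 2 * (β ^ 2 + 2 * β) := by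
  refine norm_deriv_sub_sq_div_two_mul_le hβ
    (differentiableOn_preSchwarzian hf.analytic hf.deriv_ne_zero) (fun w hw => ?_) hz
  have hre := hf.re_lt w hw
  rwa [Complex.add_re, Complex.one_re, add_lt_add_iff_left, mul_div_assoc] at hre

end Schwarzian

section Geodesic

variable {a e z z₁ z₂ : ℂ}

theorem diskMobius_diskMobius_neg (ha : ‖a‖ < 1) (hz : ‖z‖ < 1) :
    diskMobius a (diskMobius (-a) z) = z := by
  have hden : 1 - conj a * z ≠ 0 := by
    simpa [sub_eq_add_neg] using one_add_conj_mul_ne_zero ((norm_neg a).trans_lt ha) hz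
  have hself : 1 - conj a * a ≠ 0 := by
    simpa [sub_eq_add_neg] using one_add_conj_mul_ne_zero ((norm_neg a).trans_lt ha) ha
  have hnum : a + (z - a) / (1 - conj a * z) = z * (1 - conj a * a) / (1 - conj a * z) := by
    rw [eq_div_iff hden, add_mul, div_mul_cancel₀ _ hden]
    ring
  have hden' : 1 + conj a * ((z - a) / (1 - conj a * z)) =
      (1 - conj a * a) / (1 - conj a * z) := by
    rw [eq_div_iff hden, add_mul, mul_assoc, div_mul_cancel₀ _ hden]
    ring
  rw [diskMobius, diskMobius, map_neg, neg_mul, ← sub_eq_add_neg, neg_add_eq_sub, hnum, hden',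
    div_div_div_cancel_right₀ hden, mul_div_cancel_right₀ _ hself]

theorem pseudoHypDist_eq_norm_diskMobius (z₁ z₂ : ℂ) :
    pseudoHypDist z₁ z₂ = ‖diskMobius (-z₁) z₂‖ := by
  rw [pseudoHypDist, diskMobius, map_neg, neg_mul, ← sub_eq_add_neg, neg_add_eq_sub, norm_div,
    norm_div, norm_sub_rev]

theorem hypDist_eq_artanh (h₁ : ‖z₁‖ < 1) (h₂ : ‖z₂‖ < 1) :
    hypDist z₁ z₂ = Real.artanh ‖diskMobius (-z₁) z₂‖ := by
  have hlt := norm_diskMobius_lt_one ((norm_neg z₁).trans_lt h₁) h₂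
  rw [Real.artanh_eq_half_log ⟨neg_one_lt_zero.le.trans (norm_nonneg _), hlt.le⟩, hypDist,
    pseudoHypDist_eq_norm_diskMobius]

theorem hypDist_nonneg (h₁ : ‖z₁‖ < 1) (h₂ : ‖z₂‖ < 1) : 0 ≤ hypDist z₁ z₂ := by
  rw [hypDist_eq_artanh h₁ h₂]
  exact Real.artanh_nonneg (norm_nonneg _)

theorem tanh_hypDist (h₁ : ‖z₁‖ < 1) (h₂ : ‖z₂‖ < 1) :
    Real.tanh (hypDist z₁ z₂) = ‖diskMobius (-z₁) z₂‖ := by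
  rw [hypDist_eq_artanh h₁ h₂, Real.tanh_artanh ⟨neg_one_lt_zero.trans_le (norm_nonneg _),
    norm_diskMobius_lt_one ((norm_neg z₁).trans_lt h₁) h₂⟩]

/-- The unit speed hyperbolic geodesic of the disk from `a` in direction `e`, where `‖e‖ = 1`. -/
noncomputable def geodesic (a e : ℂ) (t : ℝ) : ℂ := diskMobius a (e * Real.tanh t)

/-- The denominator of `geodesic a e t` after clearing `cosh t`. It solves `m'' = m`. -/
noncomputable def geodesicDenom (a e : ℂ) (t : ℝ) : ℂ :=
  Real.cosh t + conj a * e * Real.sinh t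

theorem norm_mul_tanh_lt_one (he : ‖e‖ = 1) (t : ℝ) : ‖e * Real.tanh t‖ < 1 := by
  rw [norm_mul, he, one_mul, Complex.norm_real]
  exact Real.abs_tanh_lt_one t

theorem norm_geodesic_lt_one (ha : ‖a‖ < 1) (he : ‖e‖ = 1) (t : ℝ) : ‖geodesic a e t‖ < 1 :=
  norm_diskMobius_lt_one ha (norm_mul_tanh_lt_one he t)

@[simp]
theorem geodesic_zero : geodesic a e 0 = a := by simp [geodesic, diskMobius]

theorem hypDist_geodesic (ha : ‖a‖ < 1) (he : ‖e‖ = 1) {t : ℝ} (ht : 0 ≤ t) :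
    hypDist a (geodesic a e t) = t := by
  have hinv := diskMobius_diskMobius_neg ((norm_neg a).trans_lt ha) (norm_mul_tanh_lt_one he t)
  rw [neg_neg] at hinv
  have htanh : 0 ≤ Real.tanh t := by
    rw [Real.tanh_eq_sinh_div_cosh]
    exact div_nonneg (Real.sinh_nonneg_iff.2 ht) (Real.cosh_pos t).le
  rw [hypDist_eq_artanh ha (norm_geodesic_lt_one ha he t), geodesic, hinv, norm_mul, he, one_mul,
    Complex.norm_of_nonneg htanh, Real.artanh_tanh]

theorem exists_geodesic_eq (h₁ : ‖z₁‖ < 1) (h₂ : ‖z₂‖ < 1) :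
    ∃ e : ℂ, ‖e‖ = 1 ∧ geodesic z₁ e (hypDist z₁ z₂) = z₂ := by
  obtain ⟨e, he, hmul⟩ : ∃ e : ℂ, ‖e‖ = 1 ∧
      e * ‖diskMobius (-z₁) z₂‖ = diskMobius (-z₁) z₂ :=
    ⟨Complex.exp ((diskMobius (-z₁) z₂).arg * Complex.I), Complex.norm_exp_ofReal_mul_I _, by
      rw [mul_comm, Complex.norm_mul_exp_arg_mul_I]⟩
  refine ⟨e, he, ?_⟩
  rw [geodesic, tanh_hypDist h₁ h₂, hmul, diskMobius_diskMobius_neg h₁ h₂]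

theorem geodesicDenom_eq_cosh_mul (a e : ℂ) (t : ℝ) :
    geodesicDenom a e t = Real.cosh t * (1 + conj a * (e * Real.tanh t)) := by
  have hcosh : (Real.cosh t : ℂ) ≠ 0 := Complex.ofReal_ne_zero.2 (Real.cosh_pos t).ne'
  rw [geodesicDenom, Real.tanh_eq_sinh_div_cosh, Complex.ofReal_div]
  field_simp

theorem geodesicDenom_ne_zero (ha : ‖a‖ < 1) (he : ‖e‖ = 1) (t : ℝ) :
    geodesicDenom a e t ≠ 0 := by
  rw [geodesicDenom_eq_cosh_mul]
  exact mul_ne_zero (Complex.ofReal_ne_zero.2 (Real.cosh_pos t).ne')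
    (one_add_conj_mul_ne_zero ha (norm_mul_tanh_lt_one he t))

theorem norm_geodesicDenom_sq_mul (ha : ‖a‖ < 1) (he : ‖e‖ = 1) (t : ℝ) :
    ‖geodesicDenom a e t‖ ^ 2 * (1 - ‖geodesic a e t‖ ^ 2) = 1 - ‖a‖ ^ 2 := by
  have hcosh := (Real.cosh_pos t).ne'
  have hden := norm_ne_zero_iff.2 (one_add_conj_mul_ne_zero ha (norm_mul_tanh_lt_one he t))
  have htanh : Real.cosh t ^ 2 * (1 - Real.tanh t ^ 2) = 1 := by
    rw [Real.tanh_eq_sinh_div_cosh, div_pow, mul_sub, mul_div_cancel₀ _ (pow_ne_zero 2 hcosh),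
      mul_one, Real.cosh_sq_sub_sinh_sq]
  have hsub := norm_one_add_conj_mul_sq_sub a (e * Real.tanh t)
  rw [norm_mul e, he, one_mul, Complex.norm_real, Real.norm_eq_abs, sq_abs] at hsub
  rw [geodesicDenom_eq_cosh_mul, geodesic, diskMobius, norm_mul, norm_div, Complex.norm_real,
    Real.norm_eq_abs, mul_pow, sq_abs, mul_assoc, div_pow, mul_sub,
    mul_div_cancel₀ _ (pow_ne_zero 2 hden), mul_one, hsub, mul_left_comm, htanh, mul_one]

theorem hasDerivAt_tanh (t : ℝ) : HasDerivAt Real.tanh (1 / Real.cosh t ^ 2) t := by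
  refine (((Real.hasDerivAt_sinh t).div (Real.hasDerivAt_cosh t)
    (Real.cosh_pos t).ne').congr_of_eventuallyEq
      (Eventually.of_forall Real.tanh_eq_sinh_div_cosh)).congr_deriv ?_
  rw [← Real.cosh_sq_sub_sinh_sq t]
  ring

theorem hasDerivAt_geodesic (ha : ‖a‖ < 1) (he : ‖e‖ = 1) (t : ℝ) :
    HasDerivAt (geodesic a e)
      (((1 - ‖a‖ ^ 2 : ℝ) : ℂ) * e / geodesicDenom a e t ^ 2) t := by
  have hden := one_add_conj_mul_ne_zero ha (norm_mul_tanh_lt_one he t)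
  refine ((hasDerivAt_diskMobius hden).comp t
    ((hasDerivAt_tanh t).ofReal_comp.const_mul e)).congr_deriv ?_
  rw [geodesicDenom_eq_cosh_mul]
  push_cast
  have := Complex.ofReal_ne_zero.2 (Real.cosh_pos t).ne'
  field_simp

theorem hasDerivAt_geodesicDenom (a e : ℂ) (t : ℝ) :
    HasDerivAt (geodesicDenom a e) (Real.sinh t + conj a * e * Real.cosh t) t :=
  (Real.hasDerivAt_cosh t).ofReal_comp.add ((Real.hasDerivAt_sinh t).ofReal_comp.const_mul _)

theorem hasDerivAt_deriv_geodesicDenom (a e : ℂ) (t : ℝ) :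
    HasDerivAt (fun t : ℝ => (Real.sinh t + conj a * e * Real.cosh t : ℂ))
      (geodesicDenom a e t) t :=
  (Real.hasDerivAt_sinh t).ofReal_comp.add ((Real.hasDerivAt_cosh t).ofReal_comp.const_mul _)

end Geodesic

section ReductionOfOrder

variable {F y y' q : ℝ → ℂ} {c : ℂ}

theorem hasDerivAt_mul_of_hasDerivAt_div_sq (hy : ∀ t, HasDerivAt y (y' t) t)
    (hne : ∀ t, y t ≠ 0) (hF : ∀ t, HasDerivAt F (c / y t ^ 2) t) (t : ℝ) :
    HasDerivAt (fun t => F t * y t) (c / y t + F t * y' t) t := by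
  refine ((hF t).mul (hy t)).congr_deriv ?_
  have := hne t
  field_simp

theorem hasDerivAt_div_add_mul_of_hasDerivAt_div_sq (hy : ∀ t, HasDerivAt y (y' t) t)
    (hy' : ∀ t, HasDerivAt y' (q t * y t) t) (hne : ∀ t, y t ≠ 0)
    (hF : ∀ t, HasDerivAt F (c / y t ^ 2) t) (t : ℝ) :
    HasDerivAt (fun t => c / y t + F t * y' t) (q t * (F t * y t)) t := by
  refine (((hasDerivAt_const t c).div (hy t) (hne t)).add ((hF t).mul (hy' t))).congr_deriv ?_
  have := hne t
  field_simp
  ring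

end ReductionOfOrder

section AlongGeodesic

variable {f h h' S : ℂ → ℂ} {a e : ℂ}

theorem hasDerivAt_comp_geodesic_mul_geodesicDenom
    (hh : ∀ z ∈ ball (0 : ℂ) 1, HasDerivAt h (h' z) z) (ha : ‖a‖ < 1) (he : ‖e‖ = 1) (t : ℝ) :
    HasDerivAt (fun t => h (geodesic a e t) * geodesicDenom a e t)
      (h' (geodesic a e t) * (((1 - ‖a‖ ^ 2 : ℝ) : ℂ) * e / geodesicDenom a e t) +
        h (geodesic a e t) * (Real.sinh t + conj a * e * Real.cosh t)) t := by
  have hγ := mem_ball_zero_iff.2 (norm_geodesic_lt_one ha he t)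
  refine (((hh _ hγ).comp t (hasDerivAt_geodesic ha he t)).mul
    (hasDerivAt_geodesicDenom a e t)).congr_deriv ?_
  have := geodesicDenom_ne_zero ha he t
  simp only [Function.comp_apply]
  field_simp

theorem hasDerivAt_deriv_comp_geodesic_mul_geodesicDenom
    (hh : ∀ z ∈ ball (0 : ℂ) 1, HasDerivAt h (h' z) z)
    (hh' : ∀ z ∈ ball (0 : ℂ) 1, HasDerivAt h' (-(S z / 2) * h z) z)
    (ha : ‖a‖ < 1) (he : ‖e‖ = 1) (t : ℝ) :
    HasDerivAt
      (fun t : ℝ => h' (geodesic a e t) * (((1 - ‖a‖ ^ 2 : ℝ) : ℂ) * e / geodesicDenom a e t) +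
        h (geodesic a e t) * (Real.sinh t + conj a * e * Real.cosh t))
      ((1 - S (geodesic a e t) / 2 *
          (((1 - ‖a‖ ^ 2 : ℝ) : ℂ) * e / geodesicDenom a e t ^ 2) ^ 2) *
        (h (geodesic a e t) * geodesicDenom a e t)) t := by
  have hγ := mem_ball_zero_iff.2 (norm_geodesic_lt_one ha he t)
  have hdγ := hasDerivAt_geodesic ha he t
  have hm := geodesicDenom_ne_zero ha he t
  refine ((((hh' _ hγ).comp t hdγ).mul
    ((hasDerivAt_const t _).div (hasDerivAt_geodesicDenom a e t) hm)).add
    (((hh _ hγ).comp t hdγ).mul (hasDerivAt_deriv_geodesicDenom a e t))).congr_deriv ?_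
  simp only [Function.comp_apply, Pi.div_apply]
  field_simp
  ring

theorem hasDerivAt_comp_geodesic_sub_of_sq_mul_deriv_eq_one (hf : DifferentiableOn ℂ f (ball 0 1))
    (hh : ∀ z ∈ ball (0 : ℂ) 1, h z ^ 2 * deriv f z = 1) (ha : ‖a‖ < 1) (he : ‖e‖ = 1) (t : ℝ) :
    HasDerivAt (fun t => f (geodesic a e t) - f a)
      (((1 - ‖a‖ ^ 2 : ℝ) : ℂ) * e / (h (geodesic a e t) * geodesicDenom a e t) ^ 2) t := by
  have hγ := mem_ball_zero_iff.2 (norm_geodesic_lt_one ha he t)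
  refine (((hf.differentiableAt (isOpen_ball.mem_nhds hγ)).hasDerivAt.comp t
    (hasDerivAt_geodesic ha he t)).sub_const (f a)).congr_deriv ?_
  rw [mul_pow, mul_comm, div_mul_eq_div_div_swap, eq_div_iff fun h₀ => by simpa [h₀] using hh _ hγ,
    mul_assoc, mul_comm (deriv f _), hh _ hγ, mul_one]

theorem norm_one_sub_norm_sq_mul (ha : ‖a‖ < 1) (he : ‖e‖ = 1) :
    ‖((1 - ‖a‖ ^ 2 : ℝ) : ℂ) * e‖ = 1 - ‖a‖ ^ 2 := by
  rw [norm_mul, he, mul_one, Complex.norm_of_nonneg (one_sub_norm_sq_pos ha).le]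

theorem twoPointDistortion_geodesic_mul
    (hh : ∀ z ∈ ball (0 : ℂ) 1, h z ^ 2 * deriv f z = 1) (ha : ‖a‖ < 1) (he : ‖e‖ = 1) (t : ℝ) :
    (1 - ‖a‖ ^ 2) * twoPointDistortion f a (geodesic a e t) =
      ‖h a‖ * ‖(f (geodesic a e t) - f a) * (h (geodesic a e t) * geodesicDenom a e t)‖ := by
  have hnorm : ∀ z ∈ ball (0 : ℂ) 1, ‖h z‖ ≠ 0 ∧ ‖deriv f z‖ = 1 / ‖h z‖ ^ 2 := by
    intro z hz
    have hz₀ : ‖h z‖ ≠ 0 := norm_ne_zero_iff.2 fun h₀ => by simpa [h₀] using hh z hz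
    refine ⟨hz₀, ?_⟩
    rw [eq_div_iff (pow_ne_zero 2 hz₀), mul_comm, ← norm_pow, ← norm_mul, hh z hz, norm_one]
  obtain ⟨ha₀, ha'⟩ := hnorm a (mem_ball_zero_iff.2 ha)
  obtain ⟨hγ₀, hγ'⟩ := hnorm _ (mem_ball_zero_iff.2 (norm_geodesic_lt_one ha he t))
  have hm := norm_ne_zero_iff.2 (geodesicDenom_ne_zero ha he t)
  have hpos := one_sub_norm_sq_pos ha
  have hden := norm_geodesicDenom_sq_mul ha he t
  have hroot : ((1 - ‖a‖ ^ 2) * ‖deriv f a‖) *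
      ((1 - ‖geodesic a e t‖ ^ 2) * ‖deriv f (geodesic a e t)‖) =
      ((1 - ‖a‖ ^ 2) / (‖h a‖ * ‖h (geodesic a e t)‖ * ‖geodesicDenom a e t‖)) ^ 2 := by
    rw [ha', hγ']
    field_simp
    rw [mul_comm, hden]
  rw [twoPointDistortion, hroot, Real.sqrt_sq (by positivity), norm_sub_rev, norm_mul, norm_mul]
  field_simp

/-- The solution is `(f - f a) / √f'` times `geodesicDenom`, obtained by reduction of order from
`1 / √f'` times `geodesicDenom`. -/
theorem exists_solution_along_geodesic (hf : DifferentiableOn ℂ f (ball 0 1))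
    (hf' : ∀ z ∈ ball (0 : ℂ) 1, deriv f z ≠ 0) (ha : ‖a‖ < 1) (he : ‖e‖ = 1) :
    ∃ v v' q : ℝ → ℂ, (∀ t, HasDerivAt v (v' t) t) ∧ (∀ t, HasDerivAt v' (q t * v t) t) ∧
      (∀ t, ‖q t - 1‖ =
        ‖schwarzian f (geodesic a e t)‖ * (1 - ‖geodesic a e t‖ ^ 2) ^ 2 / 2) ∧
      v 0 = 0 ∧ v' 0 ≠ 0 ∧ ∀ t, ‖v t‖ = ‖v' 0‖ * twoPointDistortion f a (geodesic a e t) := by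
  obtain ⟨h, hh⟩ := exists_inv_sqrt_deriv hf hf'
  have hh_sq : ∀ z ∈ ball (0 : ℂ) 1, h z ^ 2 * deriv f z = 1 := fun z hz => (hh z hz).1
  have hh_ne : ∀ z ∈ ball (0 : ℂ) 1, h z ≠ 0 := fun z hz h₀ => by simpa [h₀] using hh_sq z hz
  have hm := geodesicDenom_ne_zero ha he
  have hE := norm_one_sub_norm_sq_mul ha he
  have hE₀ : ((1 - ‖a‖ ^ 2 : ℝ) : ℂ) * e ≠ 0 :=
    norm_pos_iff.1 ((one_sub_norm_sq_pos ha).trans_eq hE.symm)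
  have hF := hasDerivAt_comp_geodesic_sub_of_sq_mul_deriv_eq_one hf hh_sq ha he
  have hy := hasDerivAt_comp_geodesic_mul_geodesicDenom (fun z hz => (hh z hz).2.1) ha he
  have hy' := hasDerivAt_deriv_comp_geodesic_mul_geodesicDenom (fun z hz => (hh z hz).2.1)
    (fun z hz => (hh z hz).2.2) ha he
  have hne : ∀ t, h (geodesic a e t) * geodesicDenom a e t ≠ 0 := fun t =>
    mul_ne_zero (hh_ne _ (mem_ball_zero_iff.2 (norm_geodesic_lt_one ha he t))) (hm t)
  refine ⟨_, _, fun t => 1 - schwarzian f (geodesic a e t) / 2 *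
      (((1 - ‖a‖ ^ 2 : ℝ) : ℂ) * e / geodesicDenom a e t ^ 2) ^ 2,
    hasDerivAt_mul_of_hasDerivAt_div_sq hy hne hF,
    hasDerivAt_div_add_mul_of_hasDerivAt_div_sq hy hy' hne hF,
    fun t => ?_, by simp, ?_, fun t => ?_⟩
  · rw [sub_sub_cancel_left, norm_neg, norm_mul, norm_div, norm_pow, norm_div, hE, norm_pow,
      ← norm_geodesicDenom_sq_mul ha he t,
      mul_div_cancel_left₀ _ (pow_ne_zero 2 (norm_ne_zero_iff.2 (hm t))), Complex.norm_ofNat]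
    ring
  · simpa only [geodesic_zero, sub_self, zero_mul, add_zero] using div_ne_zero hE₀ (hne 0)
  · have hm₀ : geodesicDenom a e 0 = 1 := by simp [geodesicDenom]
    have hha := norm_ne_zero_iff.2 (hh_ne a (mem_ball_zero_iff.2 ha))
    have hdist := twoPointDistortion_geodesic_mul hh_sq ha he t
    simp only [geodesic_zero, sub_self, zero_mul, add_zero, hm₀, mul_one, norm_div, hE]
    rw [div_mul_eq_mul_div, hdist, mul_div_cancel_left₀ _ hha]

variable {z₁ z₂ : ℂ}

theorem sin_div_le_twoPointDistortion {δ : ℝ} (hδ : 0 < δ)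
    (hf : DifferentiableOn ℂ f (ball 0 1)) (hf' : ∀ z ∈ ball (0 : ℂ) 1, deriv f z ≠ 0)
    (hS : ∀ z ∈ ball (0 : ℂ) 1, ‖schwarzian f z‖ * (1 - ‖z‖ ^ 2) ^ 2 ≤ 2 * (1 + δ ^ 2))
    (h₁ : ‖z₁‖ < 1) (h₂ : ‖z₂‖ < 1) (hle : hypDist z₁ z₂ ≤ Real.pi / δ) :
    Real.sin (δ * hypDist z₁ z₂) / δ ≤ twoPointDistortion f z₁ z₂ := by
  obtain ⟨e, he, hγ⟩ := exists_geodesic_eq h₁ h₂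
  obtain ⟨v, v', q, hv, hv', hq, hv₀, hv'₀, hdist⟩ := exists_solution_along_geodesic hf hf' h₁ he
  have hq_re : ∀ t, -δ ^ 2 ≤ (q t).re := fun t => by
    have hre := (abs_le.1 (Complex.abs_re_le_norm (q t - 1))).1
    have hSt := hS _ (mem_ball_zero_iff.2 (norm_geodesic_lt_one h₁ he t))
    rw [hq t, Complex.sub_re, Complex.one_re] at hre
    linarith
  have hinner : ∀ t, ⟪v t, q t * v t⟫ = (q t).re * ‖v t‖ ^ 2 := fun t => by
    rw [Complex.inner, mul_assoc, Complex.mul_conj, Complex.re_mul_ofReal, Complex.sq_norm]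
  have key := norm_deriv_mul_sin_div_le_norm hδ hv hv'
    (fun t => (mul_le_mul_of_nonneg_right (hq_re t) (sq_nonneg _)).trans_eq (hinner t).symm)
    hv₀ (hypDist_nonneg h₁ h₂) hle
  rw [hdist, hγ] at key
  exact le_of_mul_le_mul_left key (norm_pos_iff.2 hv'₀)

theorem twoPointDistortion_le_sinh_div {k : ℝ} (hk : 0 < k)
    (hf : DifferentiableOn ℂ f (ball 0 1)) (hf' : ∀ z ∈ ball (0 : ℂ) 1, deriv f z ≠ 0)
    (hS : ∀ z ∈ ball (0 : ℂ) 1, ‖schwarzian f z‖ * (1 - ‖z‖ ^ 2) ^ 2 ≤ 2 * (k ^ 2 - 1))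
    (h₁ : ‖z₁‖ < 1) (h₂ : ‖z₂‖ < 1) :
    twoPointDistortion f z₁ z₂ ≤ Real.sinh (k * hypDist z₁ z₂) / k := by
  obtain ⟨e, he, hγ⟩ := exists_geodesic_eq h₁ h₂
  obtain ⟨v, v', q, hv, hv', hq, hv₀, hv'₀, hdist⟩ := exists_solution_along_geodesic hf hf' h₁ he
  have hq_norm : ∀ t, ‖q t‖ ≤ k ^ 2 := fun t => by
    have hSt := hS _ (mem_ball_zero_iff.2 (norm_geodesic_lt_one h₁ he t))
    have htri : ‖q t‖ ≤ ‖q t - 1‖ + ‖(1 : ℂ)‖ := norm_le_norm_sub_add _ _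
    rw [hq t, norm_one] at htri
    linarith
  have key := norm_le_norm_deriv_mul_sinh_div hk hv hv'
    (fun t => (norm_mul _ _).trans_le (mul_le_mul_of_nonneg_right (hq_norm t) (norm_nonneg _)))
    hv₀ (hypDist_nonneg h₁ h₂)
  rw [hdist, hγ] at key
  exact le_of_mul_le_mul_left key (norm_pos_iff.2 hv'₀)

end AlongGeodesic

section Extremal

variable {β : ℝ} {z : ℂ}

/-- The extremal function of `𝒢(β)`, with derivative `(1 - z) ^ β`. -/
noncomputable def extremalG (β : ℝ) (z : ℂ) : ℂ :=
  (1 - (1 - z) ^ ((1 + β : ℝ) : ℂ)) / ((1 + β : ℝ) : ℂ)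

theorem one_sub_mem_slitPlane (hz : ‖z‖ < 1) : 1 - z ∈ Complex.slitPlane :=
  .inl (by simpa using (Complex.re_le_norm z).trans_lt hz)

theorem hasDerivAt_extremalG (hβ : 1 + β ≠ 0) (hz : ‖z‖ < 1) :
    HasDerivAt (extremalG β) ((1 - z) ^ (β : ℂ)) z := by
  have hβ' : ((1 + β : ℝ) : ℂ) ≠ 0 := Complex.ofReal_ne_zero.2 hβ
  refine (((((hasDerivAt_id' z).const_sub 1).cpow_const
    (one_sub_mem_slitPlane hz)).const_sub 1).div_const _).congr_deriv ?_
  rw [show ((1 + β : ℝ) : ℂ) - 1 = β by push_cast; ring]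
  field_simp

theorem deriv_deriv_extremalG (hβ : 1 + β ≠ 0) (hz : ‖z‖ < 1) :
    deriv (deriv (extremalG β)) z = -(β * (1 - z) ^ ((β : ℂ) - 1)) := by
  have hderiv : deriv (extremalG β) =ᶠ[𝓝 z] fun z => (1 - z) ^ (β : ℂ) := by
    filter_upwards [isOpen_ball.mem_nhds (mem_ball_zero_iff.2 hz)] with w hw
    exact (hasDerivAt_extremalG hβ (mem_ball_zero_iff.1 hw)).deriv
  rw [hderiv.deriv_eq,
    (((hasDerivAt_id' z).const_sub 1).cpow_const (one_sub_mem_slitPlane hz)).deriv, mul_neg_one]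

theorem neg_half_lt_re_div_one_sub (hz : ‖z‖ < 1) : -(1 / 2) < (z / (1 - z)).re := by
  have hpos : 0 < Complex.normSq (1 - z) :=
    Complex.normSq_pos.2 (Complex.slitPlane_ne_zero (one_sub_mem_slitPlane hz))
  have hsq := one_sub_norm_sq_pos hz
  rw [Complex.sq_norm, Complex.normSq_apply] at hsq
  rw [Complex.div_re, ← add_div, lt_div_iff₀ hpos, Complex.normSq_apply, Complex.sub_re,
    Complex.sub_im, Complex.one_re, Complex.one_im]
  linarith

theorem isClassG_extremalG (hβ : 0 < β) : IsClassG β (extremalG β) := by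
  have hβ' : 1 + β ≠ 0 := by positivity
  have hderiv : ∀ z ∈ ball (0 : ℂ) 1, HasDerivAt (extremalG β) ((1 - z) ^ (β : ℂ)) z :=
    fun z hz => hasDerivAt_extremalG hβ' (mem_ball_zero_iff.1 hz)
  have hne : ∀ z ∈ ball (0 : ℂ) 1, 1 - z ≠ 0 := fun z hz =>
    Complex.slitPlane_ne_zero (one_sub_mem_slitPlane (mem_ball_zero_iff.1 hz))
  have hpow_ne : ∀ z ∈ ball (0 : ℂ) 1, (1 - z) ^ (β : ℂ) ≠ 0 := fun z hz h₀ =>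
    hne z hz ((Complex.cpow_eq_zero_iff _ _).1 h₀).1
  refine ⟨fun z hz => (hderiv z hz).differentiableAt.differentiableWithinAt, by simp [extremalG],
    by simp [(hderiv 0 (mem_ball_self one_pos)).deriv],
    fun z hz => (hderiv z hz).deriv ▸ hpow_ne z hz, fun z hz => ?_⟩
  have hquot : z * -(β * ((1 - z) ^ (β : ℂ) / (1 - z))) / (1 - z) ^ (β : ℂ) =
      ((-β : ℝ) : ℂ) * (z / (1 - z)) := by
    have := hpow_ne z hz
    push_cast
    field_simp
  rw [(hderiv z hz).deriv, deriv_deriv_extremalG hβ' (mem_ball_zero_iff.1 hz),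
    Complex.cpow_sub _ _ (hne z hz), Complex.cpow_one, hquot, Complex.add_re,
    Complex.re_ofReal_mul, Complex.one_re]
  have := mul_lt_mul_of_pos_left (neg_half_lt_re_div_one_sub (mem_ball_zero_iff.1 hz)) hβ
  linarith

theorem ofReal_mul_cpow {s : ℝ} (hs : 0 < s) {α : ℂ} (hα : α ≠ 0) (k : ℝ) :
    ((s : ℂ) * α) ^ (k : ℂ) = ((s ^ k : ℝ) : ℂ) * α ^ (k : ℂ) := by
  have hs' : (s : ℂ) ≠ 0 := Complex.ofReal_ne_zero.2 hs.ne'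
  rw [Complex.ofReal_cpow hs.le, Complex.cpow_def_of_ne_zero (mul_ne_zero hs' hα),
    Complex.cpow_def_of_ne_zero hs', Complex.cpow_def_of_ne_zero hα, ← Complex.exp_add,
    Complex.log_ofReal_mul hs hα, ← Complex.ofReal_log hs.le, add_mul]

theorem one_sub_geodesic_ofReal {x : ℝ} {e : ℂ} {t : ℝ} (hx : |x| < 1) (he : ‖e‖ = 1) :
    1 - geodesic x e t =
      ((1 - x : ℝ) : ℂ) * ((Real.cosh t - e * Real.sinh t) / geodesicDenom x e t) := by
  have hx' : ‖(x : ℂ)‖ < 1 := by rwa [Complex.norm_real]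
  have hcosh : (Real.cosh t : ℂ) ≠ 0 := Complex.ofReal_ne_zero.2 (Real.cosh_pos t).ne'
  have hden := one_add_conj_mul_ne_zero hx' (norm_mul_tanh_lt_one he t)
  have hsinh : (Real.sinh t : ℂ) = Real.cosh t * Real.tanh t := by
    rw [Real.tanh_eq_sinh_div_cosh, Complex.ofReal_div, mul_div_cancel₀ _ hcosh]
  rw [geodesicDenom_eq_cosh_mul, geodesic, diskMobius, hsinh]
  simp only [Complex.conj_ofReal, ← mul_assoc, Complex.ofReal_sub, Complex.ofReal_one] at hden ⊢
  field_simp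
  ring

theorem cpow_sq_mul_deriv_extremalG (hβ : 1 + β ≠ 0) (hz : ‖z‖ < 1) :
    ((1 - z) ^ ((-(β / 2) : ℝ) : ℂ)) ^ 2 * deriv (extremalG β) z = 1 := by
  rw [(hasDerivAt_extremalG hβ hz).deriv, ← Complex.cpow_nat_mul,
    ← Complex.cpow_add _ _ (Complex.slitPlane_ne_zero (one_sub_mem_slitPlane hz))]
  push_cast
  rw [mul_neg, mul_div_cancel₀ _ two_ne_zero, neg_add_cancel, Complex.cpow_zero]

theorem extremalG_sub_extremalG {s : ℝ} (hs : 0 < s) {α w : ℂ} (hα : α ≠ 0) (hz : 1 - z = s)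
    (hw : 1 - w = s * α) :
    extremalG β w - extremalG β z =
      ((s ^ (1 + β) : ℝ) : ℂ) * (1 - α ^ ((1 + β : ℝ) : ℂ)) / ((1 + β : ℝ) : ℂ) := by
  rw [extremalG, extremalG, hz, hw, ofReal_mul_cpow hs hα, ← Complex.ofReal_cpow hs.le]
  ring

theorem twoPointDistortion_extremalG_geodesic (hβ : 0 < 1 + β) {x : ℝ} {α e : ℂ} {t : ℝ}
    (hx : |x| < 1) (he : ‖e‖ = 1)
    (hα : α = (Real.cosh t - e * Real.sinh t) / geodesicDenom x e t) :
    twoPointDistortion (extremalG β) x (geodesic x e t) =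
      ‖1 - α ^ ((1 + β : ℝ) : ℂ)‖ * ‖α‖ ^ (-(β / 2)) * ‖geodesicDenom x e t‖ /
        ((1 + x) * (1 + β)) := by
  have hx' : ‖(x : ℂ)‖ < 1 := by rwa [Complex.norm_real]
  have hs : 0 < 1 - x := sub_pos.2 (abs_lt.1 hx).2
  have hs' : 0 < 1 + x := by linarith [(abs_lt.1 hx).1]
  have hz : 1 - (x : ℂ) = (1 - x : ℝ) := by push_cast; rfl
  have hw : 1 - geodesic x e t = ((1 - x : ℝ) : ℂ) * α := hα ▸ one_sub_geodesic_ofReal hx he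
  have hα₀ : α ≠ 0 := fun h₀ => Complex.slitPlane_ne_zero
    (one_sub_mem_slitPlane (norm_geodesic_lt_one hx' he t)) (by rw [hw, h₀, mul_zero])
  have hdist := twoPointDistortion_geodesic_mul
    (fun z hz => cpow_sq_mul_deriv_extremalG hβ.ne' (mem_ball_zero_iff.1 hz)) hx' he t
  have hpow : (1 - x) ^ (-(β / 2)) * (1 - x) ^ (-(β / 2)) * (1 - x) ^ (1 + β) = 1 - x := by
    rw [← Real.rpow_add hs, ← Real.rpow_add hs]
    ring_nf
    exact Real.rpow_one _
  have hsq : 1 - ‖(x : ℂ)‖ ^ 2 = (1 - x) * (1 + x) := by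
    rw [Complex.norm_real, Real.norm_eq_abs, sq_abs]
    ring
  rw [extremalG_sub_extremalG hs hα₀ hz hw, hz, hw, ofReal_mul_cpow hs hα₀,
    ← Complex.ofReal_cpow hs.le, hsq] at hdist
  simp only [norm_mul, norm_div, Complex.norm_real, Complex.norm_cpow_real,
    Real.norm_of_nonneg (Real.rpow_nonneg hs.le _), Real.norm_of_nonneg hβ.le] at hdist
  rw [eq_div_iff (by positivity)]
  refine mul_left_cancel₀ hs.ne' ?_
  nth_rewrite 2 [← hpow]
  field_simp at hdist
  linear_combination hdist

end Extremal

section BoundaryLimit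

variable {β t : ℝ} {e w : ℂ}

theorem log_exp_neg_two_mul (hw : |w.im| < Real.pi / 2) :
    Complex.log (Complex.exp (-2 * w)) = -2 * w := by
  have him : (-2 * w).im = -2 * w.im := by simp
  obtain ⟨hlow, hup⟩ := abs_lt.1 hw
  exact Complex.log_exp (by linarith) (by linarith)

theorem exp_neg_two_mul_mem_slitPlane (hw : |w.im| < Real.pi / 2) :
    Complex.exp (-2 * w) ∈ Complex.slitPlane := by
  refine Complex.mem_slitPlane_iff_arg.2 ⟨?_, Complex.exp_ne_zero _⟩
  have him : (-2 * w).im = -2 * w.im := by simp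
  rw [← Complex.log_im, log_exp_neg_two_mul hw, him]
  linarith [abs_lt.1 hw]

theorem norm_one_sub_exp_cpow_mul (β : ℝ) (hw : |w.im| < Real.pi / 2) :
    ‖1 - Complex.exp (-2 * w) ^ ((1 + β : ℝ) : ℂ)‖ * ‖Complex.exp (-2 * w)‖ ^ (-(β / 2)) =
      2 * ‖Complex.sinh (((1 + β : ℝ) : ℂ) * w)‖ * Real.exp (-w.re) := by
  have hsub : 1 - Complex.exp (-2 * w) ^ ((1 + β : ℝ) : ℂ) =
      2 * Complex.sinh (((1 + β : ℝ) : ℂ) * w) * Complex.exp (-(((1 + β : ℝ) : ℂ) * w)) := by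
    rw [Complex.cpow_def_of_ne_zero (Complex.exp_ne_zero _), log_exp_neg_two_mul hw,
      Complex.two_sinh, sub_mul, ← Complex.exp_add, ← Complex.exp_add, add_neg_cancel,
      Complex.exp_zero]
    ring_nf
  rw [hsub, norm_mul, norm_mul, Complex.norm_ofNat, Complex.norm_exp, Complex.norm_exp, mul_assoc,
    ← Real.exp_mul, ← Real.exp_add, Complex.neg_re, Complex.re_ofReal_mul]
  congr 2
  simp only [Complex.mul_re, Complex.neg_re, Complex.neg_im, Complex.re_ofNat, Complex.im_ofNat]
  ring

theorem sqrt_norm_cosh_sq_sub_sq_mul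
    (hexp : (Real.cosh t - e * Real.sinh t : ℂ) =
      Complex.exp (-2 * w) * (Real.cosh t + e * Real.sinh t)) :
    √‖(Real.cosh t ^ 2 - e ^ 2 * Real.sinh t ^ 2 : ℂ)‖ =
      Real.exp (-w.re) * ‖(Real.cosh t + e * Real.sinh t : ℂ)‖ := by
  have hsq : (Real.cosh t ^ 2 - e ^ 2 * Real.sinh t ^ 2 : ℂ) =
      (Complex.exp (-w) * (Real.cosh t + e * Real.sinh t)) ^ 2 := by
    rw [mul_pow, ← Complex.exp_nat_mul, sq (_ + _), ← mul_assoc, Nat.cast_ofNat, mul_neg,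
      ← neg_mul, ← hexp]
    ring
  rw [hsq, norm_pow, Real.sqrt_sq (norm_nonneg _), norm_mul, Complex.norm_exp, Complex.neg_re]

theorem tendsto_twoPointDistortion_extremalG_geodesic (hβ : 0 < 1 + β) (he : ‖e‖ = 1)
    (hw : |w.im| < Real.pi / 2)
    (hexp : (Real.cosh t - e * Real.sinh t : ℂ) =
      Complex.exp (-2 * w) * (Real.cosh t + e * Real.sinh t)) :
    Tendsto (fun x : ℝ => twoPointDistortion (extremalG β) x (geodesic x e t)) (𝓝[<] 1)
      (𝓝 (‖Complex.sinh (((1 + β : ℝ) : ℂ) * w)‖ *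
        √‖(Real.cosh t ^ 2 - e ^ 2 * Real.sinh t ^ 2 : ℂ)‖ / (1 + β))) := by
  have hm₀ : (Real.cosh t + e * Real.sinh t : ℂ) ≠ 0 := fun h₀ => by
    rw [h₀, mul_zero] at hexp
    exact (Real.cosh_pos t).ne' (Complex.ofReal_eq_zero.1 (by linear_combination (h₀ + hexp) / 2))
  have hm : Tendsto (fun x : ℝ => geodesicDenom x e t) (𝓝 1)
      (𝓝 (Real.cosh t + e * Real.sinh t)) := by
    have hcont : Continuous fun x : ℝ => geodesicDenom x e t := by
      unfold geodesicDenom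
      fun_prop
    convert hcont.tendsto 1 using 2
    simp [geodesicDenom]
  have hα : Tendsto (fun x : ℝ => (Real.cosh t - e * Real.sinh t : ℂ) / geodesicDenom x e t)
      (𝓝 1) (𝓝 (Complex.exp (-2 * w))) := by
    rw [← mul_div_cancel_right₀ (Complex.exp (-2 * w)) hm₀, ← hexp]
    exact tendsto_const_nhds.div hm hm₀
  have hpow := ((continuousAt_cpow_const (b := ((1 + β : ℝ) : ℂ))
    (exp_neg_two_mul_mem_slitPlane hw)).tendsto.comp hα).const_sub 1
  have hrpow := hα.norm.rpow_const (p := -(β / 2))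
    (.inl (norm_ne_zero_iff.2 (Complex.exp_ne_zero _)))
  have hden : Tendsto (fun x : ℝ => (1 + x) * (1 + β)) (𝓝 1) (𝓝 ((1 + 1) * (1 + β))) :=
    (tendsto_id.const_add 1).mul_const _
  have hlim := ((hpow.norm.mul hrpow).mul hm.norm).div hden (by positivity)
  rw [norm_one_sub_exp_cpow_mul β hw, mul_assoc, ← sqrt_norm_cosh_sq_sub_sq_mul hexp, mul_assoc,
    one_add_one_eq_two, mul_div_mul_left _ _ two_ne_zero] at hlim
  refine (hlim.mono_left nhdsWithin_le_nhds).congr' ?_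
  filter_upwards [Ioo_mem_nhdsLT (zero_lt_one' ℝ)] with x hx
  exact (twoPointDistortion_extremalG_geodesic hβ
    (abs_lt.2 ⟨neg_one_lt_zero.trans hx.1, hx.2⟩) he rfl).symm

theorem tendsto_twoPointDistortion_extremalG_geodesic_one (hβ : 0 < 1 + β) (ht : 0 ≤ t) :
    Tendsto (fun x : ℝ => twoPointDistortion (extremalG β) x (geodesic x 1 t)) (𝓝[<] 1)
      (𝓝 (Real.sinh ((1 + β) * t) / (1 + β))) := by
  have hexp : (Real.cosh t - 1 * Real.sinh t : ℂ) =
      Complex.exp (-2 * t) * (Real.cosh t + 1 * Real.sinh t) := by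
    rw [one_mul, ← Complex.ofReal_sub, ← Complex.ofReal_add, Real.cosh_sub_sinh,
      Real.cosh_add_sinh, Complex.ofReal_exp, Complex.ofReal_exp, ← Complex.exp_add]
    push_cast
    ring_nf
  have hlim := tendsto_twoPointDistortion_extremalG_geodesic hβ norm_one
    (by simpa using Real.pi_pos) hexp
  have hsq : (Real.cosh t ^ 2 - 1 ^ 2 * Real.sinh t ^ 2 : ℂ) = 1 := by
    rw [one_pow, one_mul]
    exact_mod_cast Real.cosh_sq_sub_sinh_sq t
  rwa [hsq, norm_one, Real.sqrt_one, mul_one, ← Complex.ofReal_mul, ← Complex.ofReal_sinh,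
    Complex.norm_of_nonneg (Real.sinh_nonneg_iff.2 (by positivity))] at hlim

/-- The limit, as `x → 1`, of the two-point distortion of `extremalG β` between `x` and
`geodesic x I t`, up to sign. Here `k = 1 + β`. -/
noncomputable def transverseProfile (k t : ℝ) : ℝ :=
  √(Real.cosh (2 * t)) * Real.sin (k * Real.arctan (Real.tanh t)) / k

theorem cosh_add_I_mul_sinh (t : ℝ) :
    (Real.cosh t + Complex.I * Real.sinh t : ℂ) =
      √(Real.cosh (2 * t)) * Complex.exp (Real.arctan (Real.tanh t) * Complex.I) := by
  have hsqrt : √(Real.cosh (2 * t)) = Real.cosh t * √(1 + Real.tanh t ^ 2) := by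
    rw [Real.sqrt_eq_iff_mul_self_eq (Real.cosh_pos _).le (by positivity), mul_mul_mul_comm,
      Real.mul_self_sqrt (by positivity), Real.cosh_two_mul, Real.tanh_eq_sinh_div_cosh]
    field_simp
  have hpos : 0 < √(1 + Real.tanh t ^ 2) := by positivity
  rw [Complex.exp_mul_I, ← Complex.ofReal_cos, ← Complex.ofReal_sin, Real.cos_arctan,
    Real.sin_arctan, hsqrt]
  have hre : Real.cosh t * √(1 + Real.tanh t ^ 2) * (1 / √(1 + Real.tanh t ^ 2)) = Real.cosh t := by
    field_simp
  have him : Real.cosh t * √(1 + Real.tanh t ^ 2) * (Real.tanh t / √(1 + Real.tanh t ^ 2)) =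
      Real.sinh t := by
    rw [Real.tanh_eq_sinh_div_cosh] at hpos ⊢
    field_simp
  rw [mul_add, ← mul_assoc, ← Complex.ofReal_mul, ← Complex.ofReal_mul, hre, him,
    mul_comm _ Complex.I]

theorem tendsto_twoPointDistortion_extremalG_geodesic_I (hβ : 0 < 1 + β) (t : ℝ) :
    Tendsto (fun x : ℝ => twoPointDistortion (extremalG β) x (geodesic x Complex.I t)) (𝓝[<] 1)
      (𝓝 |transverseProfile (1 + β) t|) := by
  set θ := Real.arctan (Real.tanh t) with hθ_def
  have hexp : (Real.cosh t - Complex.I * Real.sinh t : ℂ) =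
      Complex.exp (-2 * (θ * Complex.I)) * (Real.cosh t + Complex.I * Real.sinh t) := by
    have hconj := congrArg conj (cosh_add_I_mul_sinh t)
    simp only [map_add, map_mul, Complex.conj_ofReal, Complex.conj_I, ← Complex.exp_conj] at hconj
    rw [sub_eq_add_neg, ← neg_mul, hconj, cosh_add_I_mul_sinh, mul_left_comm, ← Complex.exp_add,
      ← hθ_def]
    ring_nf
  have hθ : |((θ : ℂ) * Complex.I).im| < Real.pi / 2 := by
    rw [Complex.im_ofReal_mul, Complex.I_im, mul_one]
    exact abs_lt.2 ⟨Real.neg_pi_div_two_lt_arctan _, Real.arctan_lt_pi_div_two _⟩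
  have hlim := tendsto_twoPointDistortion_extremalG_geodesic hβ Complex.norm_I hθ hexp
  have hsq : (Real.cosh t ^ 2 - Complex.I ^ 2 * Real.sinh t ^ 2 : ℂ) = Real.cosh (2 * t) := by
    rw [Complex.I_sq, Real.cosh_two_mul]
    push_cast
    ring
  rw [hsq, Complex.norm_of_nonneg (Real.cosh_pos _).le, ← mul_assoc, ← Complex.ofReal_mul,
    Complex.sinh_mul_I, norm_mul, Complex.norm_I, mul_one, ← Complex.ofReal_sin, Complex.norm_real,
    Real.norm_eq_abs] at hlim
  rwa [transverseProfile, abs_div, abs_mul, abs_of_nonneg (Real.sqrt_nonneg _),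
    abs_of_pos hβ, mul_comm (√_)]

end BoundaryLimit

section TransverseProfile

variable {k t δ : ℝ}

theorem hasDerivAt_arctan_tanh (t : ℝ) :
    HasDerivAt (fun t => Real.arctan (Real.tanh t)) (1 / Real.cosh (2 * t)) t := by
  refine (hasDerivAt_tanh t).arctan.congr_deriv ?_
  have := (Real.cosh_pos t).ne'
  rw [Real.cosh_two_mul, Real.tanh_eq_sinh_div_cosh]
  field_simp

theorem hasDerivAt_cosh_two_mul (t : ℝ) :
    HasDerivAt (fun t => Real.cosh (2 * t)) (2 * Real.sinh (2 * t)) t :=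
  (((hasDerivAt_id' t).const_mul 2).cosh).congr_deriv (by ring)

theorem hasDerivAt_sqrt_cosh_two_mul (t : ℝ) :
    HasDerivAt (fun t => √(Real.cosh (2 * t))) (Real.sinh (2 * t) / √(Real.cosh (2 * t))) t :=
  ((hasDerivAt_cosh_two_mul t).sqrt (Real.cosh_pos _).ne').congr_deriv
    (mul_div_mul_left _ _ two_ne_zero)

theorem hasDerivAt_sin_mul_arctan_tanh (k t : ℝ) :
    HasDerivAt (fun t => Real.sin (k * Real.arctan (Real.tanh t)))
      (Real.cos (k * Real.arctan (Real.tanh t)) * (k * (1 / Real.cosh (2 * t)))) t :=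
  ((hasDerivAt_arctan_tanh t).const_mul k).sin

theorem hasDerivAt_transverseProfile (hk : k ≠ 0) (t : ℝ) :
    HasDerivAt (transverseProfile k)
      ((Real.sinh (2 * t) * Real.sin (k * Real.arctan (Real.tanh t)) / k +
        Real.cos (k * Real.arctan (Real.tanh t))) / √(Real.cosh (2 * t))) t := by
  refine (((hasDerivAt_sqrt_cosh_two_mul t).mul
    (hasDerivAt_sin_mul_arctan_tanh k t)).div_const k).congr_deriv ?_
  have hr : 0 < √(Real.cosh (2 * t)) := Real.sqrt_pos.2 (Real.cosh_pos _)
  have hsq : Real.cosh (2 * t) = √(Real.cosh (2 * t)) ^ 2 :=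
    (Real.sq_sqrt (Real.cosh_pos _).le).symm
  generalize √(Real.cosh (2 * t)) = r at hr hsq
  rw [hsq]
  field_simp

theorem hasDerivAt_deriv_transverseProfile (hk : k ≠ 0) (t : ℝ) :
    HasDerivAt (fun t => (Real.sinh (2 * t) * Real.sin (k * Real.arctan (Real.tanh t)) / k +
        Real.cos (k * Real.arctan (Real.tanh t))) / √(Real.cosh (2 * t)))
      ((1 - (k ^ 2 - 1) / Real.cosh (2 * t) ^ 2) * transverseProfile k t) t := by
  have hr : 0 < √(Real.cosh (2 * t)) := Real.sqrt_pos.2 (Real.cosh_pos _)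
  have hsinh : HasDerivAt (fun t => Real.sinh (2 * t)) (2 * Real.cosh (2 * t)) t :=
    (((hasDerivAt_id' t).const_mul 2).sinh).congr_deriv (by ring)
  refine ((((hsinh.mul (hasDerivAt_sin_mul_arctan_tanh k t)).div_const k).add
    ((hasDerivAt_arctan_tanh t).const_mul k).cos).div
    (hasDerivAt_sqrt_cosh_two_mul t) hr.ne').congr_deriv ?_
  have hsq : Real.cosh (2 * t) = √(Real.cosh (2 * t)) ^ 2 :=
    (Real.sq_sqrt (Real.cosh_pos _).le).symm
  have hsinh_sq := Real.sinh_sq (2 * t)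
  simp only [Pi.mul_apply, Pi.add_apply, transverseProfile]
  generalize √(Real.cosh (2 * t)) = r at hr hsq hsinh_sq
  rw [hsq] at hsinh_sq ⊢
  field_simp
  linear_combination (-Real.sin (k * Real.arctan (Real.tanh t))) * hsinh_sq

theorem eventually_transverseProfile_pos (hk : k ≠ 0) :
    ∀ᶠ t in 𝓝[>] 0, 0 < transverseProfile k t := by
  have hslope : Tendsto (fun t => t⁻¹ * transverseProfile k t) (𝓝[>] 0) (𝓝 1) := by
    simpa [transverseProfile] using (hasDerivAt_transverseProfile hk 0).tendsto_slope_zero_right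
  filter_upwards [hslope.eventually_const_lt one_pos, self_mem_nhdsWithin] with t hlt (ht : 0 < t)
  exact pos_of_mul_pos_right hlt (inv_pos.2 ht).le

theorem eventually_coeff_transverseProfile_lt (hδk : δ ^ 2 < k ^ 2 - 2) :
    ∀ᶠ t in 𝓝 0, 1 - (k ^ 2 - 1) / Real.cosh (2 * t) ^ 2 < -δ ^ 2 := by
  have hcont : ContinuousAt (fun t => 1 - (k ^ 2 - 1) / Real.cosh (2 * t) ^ 2) 0 :=
    continuousAt_const.sub (continuousAt_const.div
      ((hasDerivAt_cosh_two_mul 0).continuousAt.pow 2) (by simp))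
  refine hcont.eventually_lt_const ?_
  simp only [mul_zero, Real.cosh_zero, one_pow, div_one]
  linarith

theorem eventually_transverseProfile_le_sin_div (hk : k ≠ 0) (hδ : 0 < δ)
    (hδk : δ ^ 2 < k ^ 2 - 2) :
    ∀ᶠ t in 𝓝[>] 0, transverseProfile k t ≤ Real.sin (δ * t) / δ := by
  obtain ⟨r, hr₀, hr⟩ := mem_nhdsGT_iff_exists_Ioo_subset.1
    (((eventually_coeff_transverseProfile_lt hδk).filter_mono nhdsWithin_le_nhds).and
      (eventually_transverseProfile_pos hk))
  have hr₀ : 0 < r := hr₀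
  have hsturm : ∀ t ∈ Ioo 0 r, δ * transverseProfile k t ≤ |Real.sin (δ * t)| := fun t ht => by
    have key := norm_deriv_mul_le_mul_norm_of_sturm
      (v := fun t => Real.sin (δ * t)) (v' := fun t => Real.cos (δ * t) * δ)
      (v'' := fun t => -Real.sin (δ * t) * δ * δ)
      (fun t _ => by simpa using ((hasDerivAt_id t).const_mul δ).sin)
      (fun t _ => by simpa using (((hasDerivAt_id t).const_mul δ).cos).mul_const δ)
      (fun t _ => hasDerivAt_transverseProfile hk t)
      (fun t _ => hasDerivAt_deriv_transverseProfile hk t)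
      (fun t ht => (hr ht).2) (fun t ht => by
        have := mul_le_mul_of_nonneg_right (hr ht).1.le
          (mul_nonneg (hr ht).2.le (sq_nonneg (Real.sin (δ * t))))
        rw [Real.norm_eq_abs, sq_abs, RCLike.inner_apply, conj_trivial]
        linarith)
      (by simp) (by simp [transverseProfile]) (by simp) ht
    simpa [abs_of_pos hδ] using key
  filter_upwards [Ioo_mem_nhdsGT (lt_min hr₀ (div_pos Real.pi_pos hδ))] with t ht
  rw [le_div_iff₀' hδ, ← abs_of_pos (Real.sin_pos_of_pos_of_lt_pi (mul_pos hδ ht.1)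
    ((lt_div_iff₀' hδ).1 (ht.2.trans_le (min_le_right _ _))))]
  exact hsturm t ⟨ht.1, ht.2.trans_le (min_le_left _ _)⟩

theorem sin_mul_div_lt_sin_mul_div {δ' : ℝ} (hδ : 0 < δ) (hδδ' : δ < δ') (ht : 0 < t)
    (htπ : δ' * t ≤ Real.pi) : Real.sin (δ' * t) / δ' < Real.sin (δ * t) / δ := by
  have hδ' := hδ.trans hδδ'
  have hlt : δ / δ' < 1 := (div_lt_one hδ').2 hδδ'
  have hconc := strictConcaveOn_sin_Icc.2 (left_mem_Icc.2 Real.pi_pos.le)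
    ⟨(mul_pos hδ' ht).le, htπ⟩ (mul_pos hδ' ht).ne (sub_pos.2 hlt) (div_pos hδ hδ')
    (sub_add_cancel _ _)
  have harg : δ / δ' * (δ' * t) = δ * t := by field_simp
  rw [smul_zero, Real.sin_zero, smul_zero, zero_add, zero_add, smul_eq_mul, smul_eq_mul,
    harg] at hconc
  rw [lt_div_iff₀ hδ]
  exact (by ring : _ = _).trans_lt hconc

theorem eventually_abs_transverseProfile_lt_sin_div (hk : k ≠ 0) (hδ : 0 < δ)
    (hδk : δ ^ 2 < k ^ 2 - 2) :
    ∀ᶠ t in 𝓝[>] 0, |transverseProfile k t| < Real.sin (δ * t) / δ := by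
  obtain ⟨δ', hδδ', hδ'⟩ := exists_between (Real.lt_sqrt_of_sq_lt hδk)
  have hδ'₀ := hδ.trans hδδ'
  filter_upwards [eventually_transverseProfile_pos hk,
    eventually_transverseProfile_le_sin_div hk hδ'₀ ((Real.lt_sqrt hδ'₀.le).1 hδ'),
    Ioo_mem_nhdsGT (div_pos Real.pi_pos hδ'₀)] with t hpos hle ht
  rw [abs_of_pos hpos]
  exact hle.trans_lt
    (sin_mul_div_lt_sin_mul_div hδ hδδ' ht.1 ((lt_div_iff₀' hδ'₀).1 ht.2).le)

end TransverseProfile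

section Sharpness

variable {β t M : ℝ}

theorem sinh_div_lt_sinh_div {c k : ℝ} (hc : 0 < c) (hck : c < k) :
    Real.sinh c / c < Real.sinh k / k := by
  have hconv : StrictConvexOn ℝ (Ici (0 : ℝ)) Real.sinh :=
    strictConvexOn_of_deriv2_pos (convex_Ici 0) Real.continuous_sinh.continuousOn fun x hx => by
      rw [interior_Ici] at hx
      simpa using Real.sinh_pos_iff.2 hx
  have hk := hc.trans hck
  have hlt : c / k < 1 := (div_lt_one hk).2 hck
  have hconv_k := hconv.2 self_mem_Ici hk.le hk.ne (sub_pos.2 hlt) (div_pos hc hk)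
    (sub_add_cancel _ _)
  rw [smul_zero, Real.sinh_zero, smul_zero, zero_add, zero_add, smul_eq_mul, smul_eq_mul,
    div_mul_cancel₀ _ hk.ne'] at hconv_k
  rw [div_lt_iff₀ hc]
  exact hconv_k.trans_eq (by ring)

theorem exists_hypDist_eq_of_eventually_geodesic {e : ℂ} {p : ℝ → Prop} {f : ℂ → ℂ}
    (he : ‖e‖ = 1) (ht : 0 ≤ t)
    (hp : ∀ᶠ x : ℝ in 𝓝[<] 1, p (twoPointDistortion f x (geodesic x e t))) :
    ∃ z₁ ∈ ball (0 : ℂ) 1, ∃ z₂ ∈ ball (0 : ℂ) 1,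
      hypDist z₁ z₂ = t ∧ p (twoPointDistortion f z₁ z₂) := by
  obtain ⟨x, hpx, hx⟩ := (hp.and (Ioo_mem_nhdsLT (zero_lt_one' ℝ))).exists
  have hx' : ‖(x : ℂ)‖ < 1 := by
    rw [Complex.norm_of_nonneg hx.1.le]
    exact hx.2
  exact ⟨x, mem_ball_zero_iff.2 hx', _, mem_ball_zero_iff.2 (norm_geodesic_lt_one hx' he t),
    hypDist_geodesic hx' he ht, hpx⟩

theorem exists_hypDist_eq_lt_twoPointDistortion_extremalG (hβ : 0 < 1 + β) (ht : 0 ≤ t)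
    (hM : M < Real.sinh ((1 + β) * t) / (1 + β)) :
    ∃ z₁ ∈ ball (0 : ℂ) 1, ∃ z₂ ∈ ball (0 : ℂ) 1,
      hypDist z₁ z₂ = t ∧ M < twoPointDistortion (extremalG β) z₁ z₂ :=
  exists_hypDist_eq_of_eventually_geodesic norm_one ht
    ((tendsto_twoPointDistortion_extremalG_geodesic_one hβ ht).eventually_const_lt hM)

theorem exists_hypDist_le_twoPointDistortion_extremalG_lt {δ L : ℝ} (hβ : 0 < 1 + β) (hδ : 0 < δ)
    (hδβ : δ ^ 2 < β ^ 2 + 2 * β - 1) (hL : 0 < L) :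
    ∃ z₁ ∈ ball (0 : ℂ) 1, ∃ z₂ ∈ ball (0 : ℂ) 1, hypDist z₁ z₂ ≤ L ∧
      twoPointDistortion (extremalG β) z₁ z₂ < Real.sin (δ * hypDist z₁ z₂) / δ := by
  obtain ⟨t, hlt, ht⟩ := ((eventually_abs_transverseProfile_lt_sin_div hβ.ne' hδ
    (hδβ.trans_eq (by ring))).and (Ioo_mem_nhdsGT hL)).exists
  obtain ⟨z₁, h₁, z₂, h₂, rfl, hsin⟩ := exists_hypDist_eq_of_eventually_geodesic
    (p := (· < Real.sin (δ * t) / δ)) Complex.norm_I ht.1.le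
    ((tendsto_twoPointDistortion_extremalG_geodesic_I hβ t).eventually_lt_const hlt)
  exact ⟨z₁, h₁, z₂, h₂, ht.2.le, hsin⟩

end Sharpness

theorem mainTheorem5 (β : ℝ) (hβ : Real.sqrt 2 - 1 < β) :
    -- the two bounds
    (∀ f : ℂ → ℂ, IsClassG β f →
      (∀ z₁ ∈ Metric.ball (0 : ℂ) 1, ∀ z₂ ∈ Metric.ball (0 : ℂ) 1,
        hypDist z₁ z₂ ≤ Real.pi / Real.sqrt (β ^ 2 + 2 * β - 1) →
        1 / Real.sqrt (β ^ 2 + 2 * β - 1) *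
            Real.sin (Real.sqrt (β ^ 2 + 2 * β - 1) * hypDist z₁ z₂)
          ≤ twoPointDistortion f z₁ z₂) ∧
      (∀ z₁ ∈ Metric.ball (0 : ℂ) 1, ∀ z₂ ∈ Metric.ball (0 : ℂ) 1,
        twoPointDistortion f z₁ z₂
          ≤ 1 / (1 + β) * Real.sinh ((1 + β) * hypDist z₁ z₂))) ∧
    -- sharpness, for one and the same function
    (∃ f : ℂ → ℂ, IsClassG β f ∧
      -- no smaller constant is possible in the lower bound, on the same range of pairs
      (∀ δ : ℝ, 0 < δ → δ < Real.sqrt (β ^ 2 + 2 * β - 1) →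
        ∃ z₁ ∈ Metric.ball (0 : ℂ) 1, ∃ z₂ ∈ Metric.ball (0 : ℂ) 1,
          hypDist z₁ z₂ ≤ Real.pi / Real.sqrt (β ^ 2 + 2 * β - 1) ∧
          twoPointDistortion f z₁ z₂ < 1 / δ * Real.sin (δ * hypDist z₁ z₂)) ∧
      -- no smaller constant is possible in the upper bound
      (∀ c : ℝ, 0 < c → c < 1 + β →
        ∃ z₁ ∈ Metric.ball (0 : ℂ) 1, ∃ z₂ ∈ Metric.ball (0 : ℂ) 1,
          1 / c * Real.sinh (c * hypDist z₁ z₂) < twoPointDistortion f z₁ z₂) ∧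
      -- the upper bound is approached at every hyperbolic distance
      (∀ l : ℝ, 0 < l → ∀ ε : ℝ, 0 < ε →
        ∃ z₁ ∈ Metric.ball (0 : ℂ) 1, ∃ z₂ ∈ Metric.ball (0 : ℂ) 1,
          hypDist z₁ z₂ = l ∧
          1 / (1 + β) * Real.sinh ((1 + β) * l) - ε < twoPointDistortion f z₁ z₂)) := by
  have h2 : 1 < √2 := Real.lt_sqrt_of_sq_lt (by norm_num)
  have hβ0 : 0 < β := by linarith
  have hβ1 : 0 < 1 + β := by linarith
  have hpos : 0 < β ^ 2 + 2 * β - 1 := by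
    nlinarith [Real.sq_sqrt (show (0 : ℝ) ≤ 2 by norm_num)]
  have hδβ : 0 < √(β ^ 2 + 2 * β - 1) := Real.sqrt_pos.2 hpos
  simp only [one_div_mul_eq_div]
  refine ⟨fun f hf => ⟨fun z₁ h₁ z₂ h₂ hle => ?_, fun z₁ h₁ z₂ h₂ => ?_⟩,
    extremalG β, isClassG_extremalG hβ0, fun δ hδ hlt => ?_, fun c hc hcβ => ?_,
    fun l hl ε hε => ?_⟩
  · exact sin_div_le_twoPointDistortion hδβ hf.analytic hf.deriv_ne_zero
      (fun z hz => (hf.norm_schwarzian_mul_le hβ0 hz).trans_eq (by rw [Real.sq_sqrt hpos.le]; ring))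
      (mem_ball_zero_iff.1 h₁) (mem_ball_zero_iff.1 h₂) hle
  · exact twoPointDistortion_le_sinh_div hβ1 hf.analytic hf.deriv_ne_zero
      (fun z hz => (hf.norm_schwarzian_mul_le hβ0 hz).trans_eq (by ring))
      (mem_ball_zero_iff.1 h₁) (mem_ball_zero_iff.1 h₂)
  · exact exists_hypDist_le_twoPointDistortion_extremalG_lt hβ1 hδ
      ((Real.lt_sqrt hδ.le).1 hlt) (div_pos Real.pi_pos hδβ)
  · obtain ⟨z₁, h₁, z₂, h₂, hdist, hlt⟩ := exists_hypDist_eq_lt_twoPointDistortion_extremalG hβ1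
      zero_le_one ((sinh_div_lt_sinh_div hc hcβ).trans_eq (by rw [mul_one]))
    exact ⟨z₁, h₁, z₂, h₂, by rwa [hdist, mul_one]⟩
  · exact exists_hypDist_eq_lt_twoPointDistortion_extremalG hβ1 hl.le (sub_lt_self _ hε)
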